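/- **Theorem.** There are equivalences of categories $$\omega\mathbf{Qbs}\;\simeq\;\omega\mathcal E\;\simeq\;\omega\mathbf{Cpo}(\mathbf{Qbs})\;\simeq\;\mathrm{Mod}(\mathcal P,\mathbf{Set}),$$ where the four categories are as follows. *Preliminaries.* A *quasi-Borel space* (qbs) is a set $X$ with a set $M_X\subseteq X^{\mathbb R}$ of *random elements* that contains the constant functions, is closed under precomposition with Borel maps $\mathbb R\to\mathbb R$, and is closed under case-splitting along countable Borel partitions of $\mathbb R$; a morphism $f:X\to Y$ is a function with $f\circ\alpha\in M_Y$ for all $\alpha\in M_X$. An *$\omega$cpo* is a partial order in which every $\omega$-chain has a supremum; $\omega\mathbf{Cpo}$ is the category of $\omega$cpos and Scott-continuous (monotone, $\omega$-sup-preserving) maps. $\mathbf{Sbs}$ is the category of standard Borel spaces and measurable maps. 1. $\omega\mathbf{Qbs}$: objects are triples $(P,M_P,\le_P)$ such that $(P,M_P)$ is a qbs, $(P,\le_P)$ is an $\omega$cpo, and $M_P$ is closed under pointwise suprema of pointwise $\omega$-chains; morphisms are the Scott-continuous qbs morphisms. 2. $\omega\mathcal E$: the full subcategory of $[\mathbf{Sbs}^{\mathrm{op}},\omega\mathbf{Cpo}]$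 of those $F$ that send countable coproducts in $\mathbf{Sbs}$ to products and for which $(F(\underline r))_{r\in\mathbb R}:F\mathbb R\to\prod_{r\in\mathbb R}F1$ is a full mono (i.e. reflects the order), where $\underline r:1\to\mathbb R$ is the point $r$. 3. $\omega\mathbf{Cpo}(\mathbf{Qbs})$: the $\omega$cpos internal to $\mathbf{Qbs}$, in the internal logic of $\mathbf{Qbs}$ whose predicates are the strong subobjects (subsets $S\subseteq X$ with $M_S=\{\alpha\in M_X : \alpha(\mathbb R)\subseteq S\}$). An object is a qbs $X$, a strong subobject $\le$ of $X\times X$ that is internally a partial order, and a qbs morphism $\bigvee$ from the space of internal $\omega$-chains (a subspace of the function space $X^{\mathbb N}$) to $X$ that internally yields least upper bounds. The morphisms $X\to Y$ are the points of the subspace of $Y^X$ of internally Scott-continuous maps. 4. $\mathrm{Mod}(\mathcal P,\mathbf{Set})$: models and homomorphisms of the following essentially algebraic presentation $\mathcal P$. In a model total operations are functions; partial operations are partial functions, defined exactly when their assumptions hold; an equation is satisfied when its sides agree whenever both are defined. The sorts are $\mathsf{elem},\mathsf{ineq},\mathsf{rand}$. Total operations: - $\mathsf{source},\mathsf{target}:\mathsf{ineq}\to\mathsf{elem}$,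 $\ \mathsf{refl}:\mathsf{elem}\to\mathsf{ineq}$; - $\mathsf{ev}_r:\mathsf{rand}\to\mathsf{elem}$ for $r\in\mathbb R$, $\ \mathsf{const}:\mathsf{elem}\to\mathsf{rand}$, $\ \mathsf{rearr}_\varphi:\mathsf{rand}\to\mathsf{rand}$ for $\varphi:\mathbb R\to\mathbb R$ Borel; - $\mathsf{match}_{(S_i)}:\prod_{i\in I}\mathsf{rand}\to\mathsf{rand}$ for $I\subseteq\mathbb N$ and Borel partitions $\mathbb R=\sum_{i\in I}S_i$. Partial operations, with their assumptions in braces: - $\mathsf{irr}(e_1,e_2):\mathsf{ineq}$ $\{\mathsf{source}(e_1)=\mathsf{source}(e_2),\ \mathsf{target}(e_1)=\mathsf{target}(e_2)\}$; - $\mathsf{antisym}(e_1,e_2):\mathsf{elem}$ $\{\mathsf{source}(e_1)=\mathsf{target}(e_2),\ \mathsf{target}(e_1)=\mathsf{source}(e_2)\}$; - $\mathsf{trans}(e_1,e_2):\mathsf{ineq}$ $\{\mathsf{target}(e_1)=\mathsf{source}(e_2)\}$; - $\bigvee_n e_n:\mathsf{elem}$ and $\mathsf{ub}_k(e_n)_n:\mathsf{ineq}$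 for $k\in\mathbb N$, both $\{\mathsf{target}(e_n)=\mathsf{source}(e_{n+1}) : n\in\mathbb N\}$; - $\mathsf{least}(x,(e_n)_n,(b_n)_n):\mathsf{ineq}$ for $x:\mathsf{elem}$ and $e_n,b_n:\mathsf{ineq}$ $\{\mathsf{target}(e_n)=\mathsf{source}(e_{n+1}),\ \mathsf{target}(b_n)=x,\ \mathsf{source}(e_n)=\mathsf{source}(b_n) : n\in\mathbb N\}$; - $\mathsf{ext}(\alpha,\beta):\mathsf{rand}$ for $\alpha,\beta:\mathsf{rand}$ $\{\mathsf{ev}_r(\alpha)=\mathsf{ev}_r(\beta) : r\in\mathbb R\}$; - $\mathsf{rlub}((\alpha_n)_n,(e^r_n)_{n,r}):\mathsf{rand}$ for $\alpha_n:\mathsf{rand}$ and $e^r_n:\mathsf{ineq}$ $\{\mathsf{source}(e^r_n)=\mathsf{ev}_r(\alpha_n),\ \mathsf{target}(e^r_n)=\mathsf{ev}_r(\alpha_{n+1}) : n\in\mathbb N,\ r\in\mathbb R\}$. Here $e,e_i,e_n,b_n$ always have sort $\mathsf{ineq}$. The equations are: - $e_1=\mathsf{irr}(e_1,e_2)=e_2$;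 $\ \mathsf{source}(\mathsf{refl}(x))=x=\mathsf{target}(\mathsf{refl}(x))$; $\ \mathsf{source}(e_1)=\mathsf{antisym}(e_1,e_2)=\mathsf{source}(e_2)$; - $\mathsf{source}(\mathsf{trans}(e_1,e_2))=\mathsf{source}(e_1)$, $\ \mathsf{target}(\mathsf{trans}(e_1,e_2))=\mathsf{target}(e_2)$; - $\mathsf{source}(\mathsf{ub}_k(e_n)_n)=\mathsf{source}(e_k)$, $\ \mathsf{target}(\mathsf{ub}_k(e_n)_n)=\bigvee_n e_n$; - $\mathsf{source}(\mathsf{least}(x,(e_n)_n,(b_n)_n))=\bigvee_n e_n$, $\ \mathsf{target}(\mathsf{least}(x,(e_n)_n,(b_n)_n))=x$; - $\alpha=\mathsf{ext}(\alpha,\beta)=\beta$; $\ \mathsf{ev}_r(\mathsf{const}(x))=x$; $\ \mathsf{ev}_r(\mathsf{rearr}_\varphi\alpha)=\mathsf{ev}_{\varphi(r)}\alpha$; $\ \mathsf{ev}_r(\mathsf{match}_{(S_i)}(\alpha_i)_i)=\mathsf{ev}_r(\alpha_i)$ for $r\in S_i$; - $\mathsf{ev}_r(\mathsf{rlub}((\alpha_n)_n,(e^r_n)_{n,r}))=\bigvee_n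 e^r_n$. -/

import Mathlib

open CategoryTheory OmegaCompletePartialOrder

universe u v w

namespace QBorel

/-! ## Quasi-Borel spaces -/

/-- A quasi-Borel space: a carrier with a set of random elements containing the constants and
closed under measurable precomposition and countable measurable case-splitting. -/
structure QBS : Type (u + 1) where
  carrier : Type u
  rand : Set (ℝ → carrier)
  const_mem : ∀ x : carrier, (fun _ => x) ∈ rand
  comp_mem : ∀ α ∈ rand, ∀ φ : ℝ → ℝ, Measurable φ → α ∘ φ ∈ rand
  glue_mem : ∀ (S : ℕ → Set ℝ) (α : ℕ → ℝ → carrier) (β : ℝ → carrier),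
    (∀ n, MeasurableSet (S n)) → (Pairwise fun m n => Disjoint (S m) (S n)) →
    (⋃ n, S n) = Set.univ → (∀ n, α n ∈ rand) → (∀ n, ∀ r ∈ S n, β r = α n r) → β ∈ rand

instance : CoeSort QBS.{u} (Type u) := ⟨QBS.carrier⟩

namespace QBS

/-- Morphisms of quasi-Borel spaces (the two universes may differ). -/
@[ext]
structure Hom (X : QBS.{u}) (Y : QBS.{v}) where
  toFun : X → Y
  map_rand : ∀ α ∈ X.rand, toFun ∘ α ∈ Y.rand

instance (X : QBS.{u}) (Y : QBS.{v}) : FunLike (Hom X Y) X Y where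
  coe := Hom.toFun
  coe_injective _ _ h := Hom.ext h

namespace Hom

/-- The identity morphism. -/
def id (X : QBS.{u}) : Hom X X := ⟨fun x => x, fun _ h => h⟩

/-- Composition, `g` after `f`. -/
def comp {X : QBS.{u}} {Y : QBS.{v}} {Z : QBS.{w}} (g : Hom Y Z) (f : Hom X Y) : Hom X Z :=
  ⟨fun x => g (f x), fun α h => g.map_rand _ (f.map_rand α h)⟩

end Hom

/-- The category of quasi-Borel spaces. -/
instance : Category QBS.{u} where
  Hom X Y := Hom X Y
  id X := Hom.id X
  comp f g := g.comp f

/-- The product of two quasi-Borel spaces. -/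
def prod (X : QBS.{u}) (Y : QBS.{v}) : QBS.{max u v} where
  carrier := X × Y
  rand := {α | (fun r => (α r).1) ∈ X.rand ∧ (fun r => (α r).2) ∈ Y.rand}
  const_mem x := ⟨X.const_mem x.1, Y.const_mem x.2⟩
  comp_mem _ h φ hφ := ⟨X.comp_mem _ h.1 φ hφ, Y.comp_mem _ h.2 φ hφ⟩
  glue_mem S α _ hS hd hu hα hβ :=
    ⟨X.glue_mem S (fun n r => (α n r).1) _ hS hd hu (fun n => (hα n).1)
      (fun n r hr => congrArg Prod.fst (hβ n r hr)),
     Y.glue_mem S (fun n r => (α n r).2) _ hS hd hu (fun n => (hα n).2)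
      (fun n r hr => congrArg Prod.snd (hβ n r hr))⟩

/-- Pairing into the product. -/
def Hom.pair {U : QBS.{w}} {X : QBS.{u}} {Y : QBS.{v}} (f : Hom U X) (g : Hom U Y) :
    Hom U (X.prod Y) :=
  ⟨fun a => (f a, g a), fun α h => ⟨f.map_rand α h, g.map_rand α h⟩⟩

/-- The function space: its points are the morphisms, and `α` is a random element when its
uncurrying is a morphism out of the product of the real line with `X`. -/
def fn (X : QBS.{u}) (Y : QBS.{v}) : QBS.{max u v} where
  carrier := Hom X Y
  rand := {α | ∀ φ : ℝ → ℝ, Measurable φ → ∀ β ∈ X.rand, (fun r => α (φ r) (β r)) ∈ Y.rand}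
  const_mem f := fun _ _ β hβ => f.map_rand β hβ
  comp_mem _ h ψ hψ := fun φ hφ β hβ => h (ψ ∘ φ) (hψ.comp hφ) β hβ
  glue_mem S α _ hS hd hu hα hγ := fun φ hφ β hβ =>
    Y.glue_mem (fun n => φ ⁻¹' S n) (fun n r => α n (φ r) (β r)) _ (fun n => hφ (hS n))
      (fun _ _ hmn => (hd hmn).preimage φ) (by rw [← Set.preimage_iUnion, hu, Set.preimage_univ])
      (fun n => hα n φ hφ β hβ) (fun n r hr => by rw [hγ n (φ r) hr])

/-- Evaluation. -/
def eval (X : QBS.{u}) (Y : QBS.{v}) : Hom ((fn X Y).prod X) Y where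
  toFun p := DFunLike.coe (F := Hom X Y) p.1 p.2
  map_rand _ h := h.1 (fun r => r) measurable_id _ h.2

/-- Post-composition with a morphism, as a morphism of function spaces. -/
def postcomp (A : QBS.{w}) {X : QBS.{u}} {Y : QBS.{v}} (f : Hom X Y) : Hom (fn A X) (fn A Y) where
  toFun a := Hom.comp f a
  map_rand _ h := fun φ hφ β hβ => f.map_rand _ (h φ hφ β hβ)

/-- The natural numbers as a quasi-Borel space; the random elements are the measurable maps. -/
def nat : QBS.{0} where
  carrier := ℕ
  rand := {α | Measurable α}
  const_mem _ := measurable_const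
  comp_mem _ h _ hφ := Measurable.comp h hφ
  glue_mem S α β hS _ hu hα hβ := by
    refine measurable_to_countable' fun k => ?_
    have : β ⁻¹' {k} = ⋃ n, S n ∩ α n ⁻¹' {k} := by
      ext r
      simp only [Set.mem_preimage, Set.mem_singleton_iff, Set.mem_iUnion, Set.mem_inter_iff]
      constructor
      · intro h
        obtain ⟨n, hn⟩ := Set.mem_iUnion.1 (hu ▸ Set.mem_univ r)
        exact ⟨n, hn, by rw [← hβ n r hn, h]⟩
      · rintro ⟨n, hn, h⟩
        rw [hβ n r hn, h]
    rw [this]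
    exact MeasurableSet.iUnion fun n => (hS n).inter (hα n (measurableSet_singleton k))

/-- A strong mono: an injective map such that the random elements of `X` are exactly the random
elements of `Y` that take values in the image. -/
def Hom.IsStrongMono {X : QBS.{u}} {Y : QBS.{v}} (m : Hom X Y) : Prop :=
  Function.Injective m ∧
    (fun α : ℝ → X => m ∘ α) '' X.rand = Y.rand ∩ {β | ∀ r, β r ∈ Set.range m}

/-- A sub-space of `X`, i.e. a strong subobject of `X`. It is represented by its set of points;
see `Subspace.isStrongMono_incl` and `Hom.IsStrongMono.exists_iso`. -/
def Subspace (X : QBS.{u}) : Type u := Set X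

namespace Subspace

/-- The underlying quasi-Borel space of a sub-space. -/
def toQBS {X : QBS.{u}} (S : Subspace X) : QBS.{u} where
  carrier := {x : X // x ∈ (show Set X from S)}
  rand := {α | (fun r => (α r).1) ∈ X.rand}
  const_mem x := X.const_mem x.1
  comp_mem _ h φ hφ := X.comp_mem _ h φ hφ
  glue_mem T α _ hT hd hu hα hβ := X.glue_mem T (fun n r => (α n r).1) _ hT hd hu hα
    (fun n r hr => congrArg Subtype.val (hβ n r hr))

/-- The inclusion of a sub-space. -/
def incl {X : QBS.{u}} (S : Subspace X) : Hom S.toQBS X := ⟨fun x => x.1, fun _ h => h⟩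

/-- The generalised element `x` of `X` at stage `U` belongs to the sub-space `S`. -/
def Holds {X : QBS.{u}} (S : Subspace X) {U : QBS.{v}} (x : Hom U X) : Prop :=
  ∃ k : Hom U S.toQBS, S.incl.comp k = x

theorem holds_iff {X : QBS.{u}} (S : Subspace X) {U : QBS.{v}} (x : Hom U X) :
    S.Holds x ↔ ∀ a, x a ∈ (show Set X from S) := by
  constructor
  · rintro ⟨k, rfl⟩ a
    exact (k a).2
  · intro h
    exact ⟨⟨fun a => ⟨x a, h a⟩, fun α hα => x.map_rand α hα⟩, rfl⟩

theorem isStrongMono_incl {X : QBS.{u}} (S : Subspace X) : S.incl.IsStrongMono := by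
  refine ⟨Subtype.val_injective, ?_⟩
  ext β
  constructor
  · rintro ⟨α, hα, rfl⟩
    exact ⟨hα, fun r => ⟨α r, rfl⟩⟩
  · rintro ⟨hβ, hr⟩
    choose α hα using hr
    have : (fun r => (α r).1) = β := funext hα
    exact ⟨α, by change (fun r => (α r).1) ∈ X.rand; rw [this]; exact hβ, this⟩

end Subspace

theorem Hom.IsStrongMono.exists_iso {X : QBS.{u}} {Y : QBS.{v}} {m : Hom X Y}
    (hm : m.IsStrongMono) : ∃ (S : Subspace Y) (i : Hom X S.toQBS) (j : Hom S.toQBS X),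
      i.comp j = Hom.id _ ∧ j.comp i = Hom.id _ ∧ S.incl.comp i = m := by
  let S : Subspace Y := Set.range m
  have hj : ∀ y : S.toQBS, ∃ x, m x = y.1 := fun y => y.2
  choose j hj using hj
  refine ⟨S, ⟨fun x => ⟨m x, x, rfl⟩, fun α h => m.map_rand α h⟩, ⟨j, fun β hβ => ?_⟩, ?_, ?_, rfl⟩
  · obtain ⟨α, hα, h⟩ := hm.2.symm.subset
      (show (fun r => (β r).1) ∈ _ from ⟨hβ, fun r => (β r).2⟩)
    have : j ∘ β = α := funext fun r => hm.1 ((hj _).trans (congrFun h r).symm)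
    rw [this]
    exact hα
  · exact Hom.ext (funext fun y => Subtype.ext (hj y))
  · exact Hom.ext (funext fun x => hm.1 (hj _))

end QBS

/-! ## ω-quasi-Borel spaces -/

/-- An ω-quasi-Borel space: a quasi-Borel space and an ωcpo on the same carrier such that the
random elements are closed under pointwise suprema of pointwise ω-chains. -/
structure WQbs : Type (u + 1) extends QBS.{u} where
  [str : OmegaCompletePartialOrder carrier]
  sup_mem : ∀ c : Chain (ℝ → carrier), (∀ n, c n ∈ rand) →
    (fun r => ωSup (c.map (Pi.evalOrderHom r))) ∈ rand

attribute [instance] WQbs.str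

namespace WQbs

/-- Morphisms: Scott-continuous maps that are morphisms of quasi-Borel spaces. -/
@[ext]
structure Hom (P Q : WQbs.{u}) extends P.carrier →𝒄 Q.carrier where
  map_rand : ∀ α ∈ P.rand, toFun ∘ α ∈ Q.rand

/-- The category of ω-quasi-Borel spaces. -/
instance : Category WQbs.{u} where
  Hom P Q := Hom P Q
  id P := ⟨ContinuousHom.id, fun _ h => h⟩
  comp f g := ⟨g.toContinuousHom.comp f.toContinuousHom,
    fun α h => g.map_rand _ (f.map_rand α h)⟩

end WQbs

/-! ## Separated sheaves of ωcpos on standard Borel spaces -/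

/-- The category of standard Borel spaces and measurable maps. -/
abbrev Sbs : Type 1 :=
  ObjectProperty.FullSubcategory fun X : MeasCat.{0} => StandardBorelSpace X

namespace Sbs

/-- The real line. -/
def real : Sbs := ⟨MeasCat.of ℝ, inferInstanceAs (StandardBorelSpace ℝ)⟩

/-- The one-point space. -/
def one : Sbs := ⟨MeasCat.of Unit, inferInstanceAs (StandardBorelSpace Unit)⟩

/-- The point `r` of the real line, as a map from the one-point space. -/
def point (r : ℝ) : one ⟶ real :=
  ObjectProperty.homMk (⟨fun _ => r, measurable_const⟩ : MeasCat.of Unit ⟶ MeasCat.of ℝ)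

end Sbs

/-- A Scott-continuous map is a full mono when it reflects the order. -/
def FullMono {P : Type u} {Q : Type v} [OmegaCompletePartialOrder P]
    [OmegaCompletePartialOrder Q] (f : P →𝒄 Q) : Prop :=
  ∀ a b, f a ≤ f b → a ≤ b

/-- The comparison map from `F ℝ` to the `ℝ`-fold power of `F 1`. -/
def sepMap (F : Sbsᵒᵖ ⥤ ωCPO.{u}) :
    (F.obj (.op Sbs.real)).carrier →𝒄 (ℝ → (F.obj (.op Sbs.one)).carrier) where
  toFun a r := F.map (Sbs.point r).op a
  monotone' _ _ h r := (show ContinuousHom _ _ from F.map (Sbs.point r).op).monotone h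
  map_ωSup' c := funext fun r => (show ContinuousHom _ _ from F.map (Sbs.point r).op).continuous c

/-- Presheaves of ωcpos that send countable coproducts of standard Borel spaces to products and
are separated. -/
def IsSeparatedSheaf : ObjectProperty (Sbsᵒᵖ ⥤ ωCPO.{u}) := fun F =>
  (∀ (J : Type) [Countable J], Limits.PreservesLimitsOfShape (Discrete J) F) ∧
    FullMono (sepMap F)

/-- The category of separated sheaves of ωcpos on standard Borel spaces. -/
abbrev WE : Type (u + 1) := (IsSeparatedSheaf.{u}).FullSubcategory

/-! ## ωcpos internal to quasi-Borel spaces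

The axioms are read in the internal logic of quasi-Borel spaces whose predicates are the
sub-spaces: a formula is valid when it holds of all generalised elements at all stages, and
universal quantifiers and implications range over all later stages. Comprehension produces
the sub-space of the points at which a formula holds. -/

open QBS

/-- The order of the natural numbers, as a sub-space. -/
def natLe : Subspace (QBS.nat.prod QBS.nat) := {p : ℕ × ℕ | p.1 ≤ p.2}

/-- The internal space of ω-chains with respect to a relation `le` on `X`: the sub-space of the
function space from the natural numbers to `X` that consists of the monotone sequences. -/
def chains {X : QBS.{u}} (le : Subspace (X.prod X)) : Subspace (QBS.fn QBS.nat X) :=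
  {a : QBS.Hom QBS.nat X | ∀ (U : QBS.{u}) (m n : QBS.Hom U QBS.nat),
    natLe.Holds (m.pair n) → le.Holds ((a.comp m).pair (a.comp n))}

/-- The `n`-th term of a generalised chain `a`, for a generalised natural number `n`. -/
def term {X : QBS.{u}} {le : Subspace (X.prod X)} {U : QBS.{u}}
    (a : QBS.Hom U (chains le).toQBS) (n : QBS.Hom U QBS.nat) : QBS.Hom U X :=
  (QBS.eval QBS.nat X).comp (((chains le).incl.comp a).pair n)

/-- An ωcpo internal to quasi-Borel spaces: a partial order relation together with a supremum
operation, which is a morphism from the space of chains. -/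
structure IntWCpo : Type (u + 1) where
  obj : QBS.{u}
  le : Subspace (obj.prod obj)
  refl : ∀ (U : QBS.{u}) (x : QBS.Hom U obj), le.Holds (x.pair x)
  antisymm : ∀ (U : QBS.{u}) (x y : QBS.Hom U obj),
    le.Holds (x.pair y) → le.Holds (y.pair x) → x = y
  trans : ∀ (U : QBS.{u}) (x y z : QBS.Hom U obj),
    le.Holds (x.pair y) → le.Holds (y.pair z) → le.Holds (x.pair z)
  sup : QBS.Hom (chains le).toQBS obj
  le_sup : ∀ (U : QBS.{u}) (a : QBS.Hom U (chains le).toQBS) (n : QBS.Hom U QBS.nat),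
    le.Holds ((term a n).pair (sup.comp a))
  sup_le : ∀ (U : QBS.{u}) (a : QBS.Hom U (chains le).toQBS) (x : QBS.Hom U obj),
    (∀ (V : QBS.{u}) (f : QBS.Hom V U) (n : QBS.Hom V QBS.nat),
      le.Holds ((term (a.comp f) n).pair (x.comp f))) →
    le.Holds ((sup.comp a).pair x)

namespace IntWCpo

/-- The sub-space of the function space that consists of the internally Scott-continuous maps:
`f` is monotone, and whenever the chain `b` is the image under `f` of the chain `a`, the
supremum of `b` is the image of the supremum of `a`. -/
def scott (P Q : IntWCpo.{u}) : Subspace (QBS.fn P.obj Q.obj) :=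
  {f : QBS.Hom P.obj Q.obj |
    (∀ (U : QBS.{u}) (x y : QBS.Hom U P.obj),
      P.le.Holds (x.pair y) → Q.le.Holds ((f.comp x).pair (f.comp y))) ∧
    (∀ (U : QBS.{u}) (a : QBS.Hom U (chains P.le).toQBS) (b : QBS.Hom U (chains Q.le).toQBS),
      (QBS.postcomp QBS.nat f).comp ((chains P.le).incl.comp a) = (chains Q.le).incl.comp b →
      f.comp (P.sup.comp a) = Q.sup.comp b)}

theorem id_mem (P : IntWCpo.{u}) :
    QBS.Hom.id P.obj ∈ (show Set (QBS.Hom P.obj P.obj) from scott P P) := by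
  refine ⟨fun U x y h => h, fun U a b h => ?_⟩
  have : a = b := by
    refine QBS.Hom.ext (funext fun t => Subtype.ext ?_)
    exact congrArg (fun k => QBS.Hom.toFun k t) h
  subst this
  rfl

theorem comp_mem {P Q R : IntWCpo.{u}} {f : QBS.Hom P.obj Q.obj} {g : QBS.Hom Q.obj R.obj}
    (hf : f ∈ (show Set (QBS.Hom P.obj Q.obj) from scott P Q))
    (hg : g ∈ (show Set (QBS.Hom Q.obj R.obj) from scott Q R)) :
    g.comp f ∈ (show Set (QBS.Hom P.obj R.obj) from scott P R) := by
  refine ⟨fun U x y h => hg.1 U _ _ (hf.1 U _ _ h), fun U a c h => ?_⟩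
  let b : QBS.Hom U (chains Q.le).toQBS :=
    ⟨fun t => ⟨f.comp (a t).1, fun V m n hmn => hf.1 V _ _ ((a t).2 V m n hmn)⟩,
      fun α hα =>
        ((QBS.postcomp QBS.nat f).comp ((chains P.le).incl.comp a)).map_rand α hα⟩
  have h₁ : f.comp (P.sup.comp a) = Q.sup.comp b := hf.2 U a b rfl
  have h₂ : g.comp (Q.sup.comp b) = R.sup.comp c := hg.2 U b c h
  rw [← h₂, ← h₁]
  rfl

/-- The category of internal ωcpos; the morphisms are the points of the sub-space of internally
Scott-continuous maps. -/
instance : Category IntWCpo.{u} where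
  Hom P Q := (scott P Q).toQBS
  id P := ⟨QBS.Hom.id P.obj, id_mem P⟩
  comp f g := ⟨QBS.Hom.comp g.1 f.1, comp_mem f.2 g.2⟩

end IntWCpo

/-! ## Essentially algebraic presentations and their models in sets -/

/-- A many-sorted signature with possibly infinite arities. -/
structure Signature (S : Type) where
  Op : Type
  Ar : Op → Type
  arg : (o : Op) → Ar o → S
  res : Op → S

namespace Signature

variable {S : Type}

/-- The combined signature. -/
def sum (Sg Th : Signature S) : Signature S where
  Op := Sg.Op ⊕ Th.Op
  Ar := Sum.elim Sg.Ar Th.Ar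
  arg := fun o => match o with
    | .inl o => Sg.arg o
    | .inr o => Th.arg o
  res := Sum.elim Sg.res Th.res

/-- The variables `x i : s i`, one for each argument of the operation `o`. -/
def vars (Sg : Signature S) (o : Sg.Op) (s : S) : Type := {i : Sg.Ar o // Sg.arg o i = s}

end Signature

/-- The sorted terms over a family of variables. -/
inductive Term {S : Type} (Sg : Signature S) (V : S → Type) : S → Type
  | var {s : S} (x : V s) : Term Sg V s
  | op (o : Sg.Op) (t : ∀ i, Term Sg V (Sg.arg o i)) : Term Sg V (Sg.res o)

/-- An equation between two terms of the same sort. -/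
structure Eqn {S : Type} (Sg : Signature S) (V : S → Type) where
  sort : S
  lhs : Term Sg V sort
  rhs : Term Sg V sort

/-- An essentially algebraic `κ`-ary presentation. -/
structure EssAlgPres (κ : Cardinal.{0}) where
  /-- the sorts -/
  Srt : Type
  /-- the total operations -/
  tot : Signature Srt
  /-- the partial operations -/
  par : Signature Srt
  regular : κ.IsRegular
  card_sorts : Cardinal.mk Srt < κ
  card_tot : ∀ o, Cardinal.mk (tot.Ar o) < κ
  card_par : ∀ o, Cardinal.mk (par.Ar o) < κ
  /-- the assumptions of a partial operation -/
  assum : (o : par.Op) → Set (Eqn tot (par.vars o))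
  /-- the equations that the models have to satisfy -/
  eqs : Set (Σ V : Srt → Type, Eqn (tot.sum par) V)

/-- A partial algebra in sets: the total operations are functions, the partial ones are partial
functions. -/
structure PartialAlgebra {κ : Cardinal.{0}} (P : EssAlgPres κ) : Type (u + 1) where
  carrier : P.Srt → Type u
  tot : (o : P.tot.Op) → (∀ i, carrier (P.tot.arg o i)) → carrier (P.tot.res o)
  par : (o : P.par.Op) → (∀ i, carrier (P.par.arg o i)) → Part (carrier (P.par.res o))

namespace PartialAlgebra

variable {κ : Cardinal.{0}} {P : EssAlgPres κ} (A : PartialAlgebra.{u} P)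

/-- The value of a term over the total operations. -/
def evalTot {V : P.Srt → Type} (v : ∀ s, V s → A.carrier s) :
    ∀ {s : P.Srt}, Term P.tot V s → A.carrier s
  | _, .var x => v _ x
  | _, .op o t => A.tot o fun i => evalTot v (t i)

/-- All operations, as partial functions. -/
def op : (o : (P.tot.sum P.par).Op) → (∀ i, A.carrier ((P.tot.sum P.par).arg o i)) →
    Part (A.carrier ((P.tot.sum P.par).res o))
  | .inl o => fun a => Part.some (A.tot o a)
  | .inr o => fun a => A.par o a

/-- The value of a term over all operations. It is defined when the values of all subterms are
defined and lie in the domain of the operation. -/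
def eval {V : P.Srt → Type} (v : ∀ s, V s → A.carrier s) :
    ∀ {s : P.Srt}, Term (P.tot.sum P.par) V s → Part (A.carrier s)
  | _, .var x => Part.some (v _ x)
  | _, .op o t => (⟨∀ i, (eval v (t i)).Dom, fun h i => (eval v (t i)).get (h i)⟩ :
      Part (∀ i, A.carrier ((P.tot.sum P.par).arg o i))).bind (A.op o)

/-- The valuation of the variables of an operation by a tuple of arguments. -/
def valuation {o : P.par.Op} (a : ∀ i, A.carrier (P.par.arg o i)) (s : P.Srt)
    (x : P.par.vars o s) : A.carrier s :=
  x.2 ▸ a x.1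

end PartialAlgebra

/-- A model: a partial algebra whose partial operations are defined exactly where their
assumptions hold, and which satisfies each equation of the presentation whenever both of its
sides are defined. -/
structure Model {κ : Cardinal.{0}} (P : EssAlgPres κ) : Type (u + 1)
    extends PartialAlgebra.{u} P where
  dom_iff : ∀ (o : P.par.Op) (a : ∀ i, carrier (P.par.arg o i)),
    (par o a).Dom ↔ ∀ e ∈ P.assum o,
      toPartialAlgebra.evalTot (toPartialAlgebra.valuation a) e.lhs =
        toPartialAlgebra.evalTot (toPartialAlgebra.valuation a) e.rhs
  sat : ∀ e ∈ P.eqs, ∀ v : (∀ s, e.1 s → carrier s),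
    ∀ x ∈ toPartialAlgebra.eval v e.2.lhs, ∀ y ∈ toPartialAlgebra.eval v e.2.rhs, x = y

namespace Model

variable {κ : Cardinal.{0}} {P : EssAlgPres κ}

/-- Homomorphisms: families of functions that preserve all operations. -/
@[ext]
structure Hom (A B : Model.{u} P) where
  map : ∀ s, A.carrier s → B.carrier s
  map_tot : ∀ (o : P.tot.Op) (a : ∀ i, A.carrier (P.tot.arg o i)),
    map _ (A.tot o a) = B.tot o fun i => map _ (a i)
  map_par : ∀ (o : P.par.Op) (a : ∀ i, A.carrier (P.par.arg o i)),
    ∀ x ∈ A.par o a, map _ x ∈ B.par o fun i => map _ (a i)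

/-- The category of models in sets. -/
instance : Category (Model.{u} P) where
  Hom A B := Hom A B
  id A := ⟨fun _ x => x, fun _ _ => rfl, fun _ _ _ h => h⟩
  comp f g := ⟨fun s x => g.map s (f.map s x),
    fun o a => by rw [f.map_tot, g.map_tot],
    fun o a x h => g.map_par o _ _ (f.map_par o a x h)⟩

end Model

/-! ## The presentation of ω-quasi-Borel spaces -/

/-- A countable measurable partition of the real line, indexed by a set of natural numbers. -/
structure MeasPartition where
  I : Set ℕ
  S : I → Set ℝ
  meas : ∀ i, MeasurableSet (S i)
  disj : Pairwise fun i j => Disjoint (S i) (S j)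
  cover : (⋃ i, S i) = Set.univ

namespace Pres

/-- The sorts: elements, inequations, random elements. -/
inductive Srt : Type
  | elem | ineq | rand

/-- The total operations. -/
inductive TotOp : Type
  | source | target | refl
  | ev (r : ℝ) | const | rearrange (φ : {φ : ℝ → ℝ // Measurable φ}) | cases (p : MeasPartition)

/-- The signature of total operations. -/
def tot : Signature Srt where
  Op := TotOp
  Ar := fun o => match o with
    | .cases p => p.I
    | _ => Unit
  arg := fun o _ => match o with
    | .source => .ineq
    | .target => .ineq
    | .refl => .elem
    | .ev _ => .rand
    | .const => .elem
    | .rearrange _ => .rand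
    | .cases _ => .rand
  res := fun o => match o with
    | .source => .elem
    | .target => .elem
    | .refl => .ineq
    | .ev _ => .elem
    | .const => .rand
    | .rearrange _ => .rand
    | .cases _ => .rand

/-- The partial operations. -/
inductive ParOp : Type
  | irrelevance | antisym | trans
  | lub | ub (k : ℕ) | least
  | extensionality
  | rlub

/-- The signature of partial operations. -/
def par : Signature Srt where
  Op := ParOp
  Ar := fun o => match o with
    | .irrelevance => Fin 2
    | .antisym => Fin 2
    | .trans => Fin 2
    | .lub => ℕ
    | .ub _ => ℕ
    | .least => Unit ⊕ ℕ ⊕ ℕ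
    | .extensionality => Fin 2
    | .rlub => ℕ ⊕ ℕ × ℝ
  arg := fun o => match o with
    | .irrelevance => fun _ => .ineq
    | .antisym => fun _ => .ineq
    | .trans => fun _ => .ineq
    | .lub => fun _ => .ineq
    | .ub _ => fun _ => .ineq
    | .least => Sum.elim (fun _ => .elem) (fun _ => .ineq)
    | .extensionality => fun _ => .rand
    | .rlub => Sum.elim (fun _ => .rand) (fun _ => .ineq)
  res := fun o => match o with
    | .irrelevance => .ineq
    | .antisym => .elem
    | .trans => .ineq
    | .lub => .elem
    | .ub _ => .ineq
    | .least => .ineq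
    | .extensionality => .rand
    | .rlub => .rand

section Assumptions

variable {V : Srt → Type}

/-- The term `source e`, over the total operations. -/
def tsource (e : Term tot V .ineq) : Term tot V .elem := .op (Sg := tot) TotOp.source fun _ => e

/-- The term `target e`, over the total operations. -/
def ttarget (e : Term tot V .ineq) : Term tot V .elem := .op (Sg := tot) TotOp.target fun _ => e

/-- The term `ev r α`, over the total operations. -/
def tev (r : ℝ) (α : Term tot V .rand) : Term tot V .elem := .op (Sg := tot) (TotOp.ev r) fun _ => α

/-- The variable of a partial operation that stands for its argument with index `i`. -/
def tvar (o : ParOp) (i : par.Ar o) : Term tot (par.vars o) (par.arg o i) := .var ⟨i, rfl⟩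

/-- The assumptions of the partial operations. -/
def assum : (o : ParOp) → Set (Eqn tot (par.vars o))
  | .irrelevance =>
      let e : Fin 2 → Term tot (par.vars ParOp.irrelevance) .ineq := tvar .irrelevance
      {⟨.elem, tsource (e 0), tsource (e 1)⟩, ⟨.elem, ttarget (e 0), ttarget (e 1)⟩}
  | .antisym =>
      let e : Fin 2 → Term tot (par.vars ParOp.antisym) .ineq := tvar .antisym
      {⟨.elem, tsource (e 0), ttarget (e 1)⟩, ⟨.elem, ttarget (e 0), tsource (e 1)⟩}
  | .trans =>
      let e : Fin 2 → Term tot (par.vars ParOp.trans) .ineq := tvar .trans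
      {⟨.elem, ttarget (e 0), tsource (e 1)⟩}
  | .lub =>
      let e : ℕ → Term tot (par.vars ParOp.lub) .ineq := tvar .lub
      Set.range fun n : ℕ => ⟨.elem, ttarget (e n), tsource (e (n + 1))⟩
  | .ub k =>
      let e : ℕ → Term tot (par.vars (ParOp.ub k)) .ineq := tvar (.ub k)
      Set.range fun n : ℕ => ⟨.elem, ttarget (e n), tsource (e (n + 1))⟩
  | .least =>
      let x : Term tot (par.vars ParOp.least) .elem := tvar .least (.inl ())
      let e : ℕ → Term tot (par.vars ParOp.least) .ineq := fun n => tvar .least (.inr (.inl n))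
      let b : ℕ → Term tot (par.vars ParOp.least) .ineq := fun n => tvar .least (.inr (.inr n))
      (Set.range fun n : ℕ => ⟨.elem, ttarget (e n), tsource (e (n + 1))⟩) ∪
      (Set.range fun n : ℕ => ⟨.elem, ttarget (b n), x⟩) ∪
      (Set.range fun n : ℕ => ⟨.elem, tsource (e n), tsource (b n)⟩)
  | .extensionality =>
      let α : Fin 2 → Term tot (par.vars ParOp.extensionality) .rand := tvar .extensionality
      Set.range fun r : ℝ => ⟨.elem, tev r (α 0), tev r (α 1)⟩
  | .rlub =>
      let α : ℕ → Term tot (par.vars ParOp.rlub) .rand := fun n => tvar .rlub (.inl n)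
      let e : ℕ → ℝ → Term tot (par.vars ParOp.rlub) .ineq := fun n r => tvar .rlub (.inr (n, r))
      (Set.range fun p : ℕ × ℝ => ⟨.elem, tsource (e p.1 p.2), tev p.2 (α p.1)⟩) ∪
      (Set.range fun p : ℕ × ℝ => ⟨.elem, ttarget (e p.1 p.2), tev p.2 (α (p.1 + 1))⟩)

end Assumptions

/-- The combined signature. -/
def all : Signature Srt := tot.sum par

section Equations

variable {V : Srt → Type}

/-- The term `source e`. -/
def source (e : Term all V .ineq) : Term all V .elem :=
  .op (Sg := all) (.inl TotOp.source) fun _ => e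

/-- The term `target e`. -/
def target (e : Term all V .ineq) : Term all V .elem :=
  .op (Sg := all) (.inl TotOp.target) fun _ => e

/-- The term `ev r α`. -/
def ev (r : ℝ) (α : Term all V .rand) : Term all V .elem :=
  .op (Sg := all) (.inl (TotOp.ev r)) fun _ => α

/-- The term `lub e`. -/
def lub (e : ℕ → Term all V .ineq) : Term all V .elem :=
  .op (Sg := all) (.inr ParOp.lub) e

/-- The variable that stands for the argument with index `i` of the operation `o`. -/
def var (o : all.Op) (i : all.Ar o) : Term all (all.vars o) (all.arg o i) := .var ⟨i, rfl⟩

/-- The operation `o` applied to its variables. -/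
def gen (o : all.Op) : Term all (all.vars o) (all.res o) := .op o (var o)

/-- The equations for the total operation `o`, over the variables of `o`. -/
def eqsTot : (o : TotOp) → Set (Eqn all (all.vars (.inl o)))
  | .source => ∅
  | .target => ∅
  | .refl =>
      let x : Term all (all.vars (.inl TotOp.refl)) .elem := var (.inl TotOp.refl) ()
      let t : Term all (all.vars (.inl TotOp.refl)) .ineq := gen (.inl TotOp.refl)
      {⟨.elem, source t, x⟩, ⟨.elem, x, target t⟩}
  | .ev _ => ∅
  | .const =>
      let x : Term all (all.vars (.inl TotOp.const)) .elem := var (.inl TotOp.const) ()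
      let t : Term all (all.vars (.inl TotOp.const)) .rand := gen (.inl TotOp.const)
      Set.range fun r : ℝ => ⟨.elem, ev r t, x⟩
  | .rearrange φ =>
      let α : Term all (all.vars (.inl (TotOp.rearrange φ))) .rand :=
        var (.inl (TotOp.rearrange φ)) ()
      let t : Term all (all.vars (.inl (TotOp.rearrange φ))) .rand := gen (.inl (TotOp.rearrange φ))
      Set.range fun r : ℝ => ⟨.elem, ev r t, ev (φ.1 r) α⟩
  | .cases p =>
      let α : p.I → Term all (all.vars (.inl (TotOp.cases p))) .rand := var (.inl (TotOp.cases p))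
      let t : Term all (all.vars (.inl (TotOp.cases p))) .rand := gen (.inl (TotOp.cases p))
      Set.range fun q : (Σ i : p.I, p.S i) => ⟨.elem, ev q.2.1 t, ev q.2.1 (α q.1)⟩

/-- The equations for the partial operation `o`, over the variables of `o`. -/
def eqsPar : (o : ParOp) → Set (Eqn all (all.vars (.inr o)))
  | .irrelevance =>
      let e : Fin 2 → Term all (all.vars (.inr ParOp.irrelevance)) .ineq :=
        var (.inr ParOp.irrelevance)
      let t : Term all (all.vars (.inr ParOp.irrelevance)) .ineq := gen (.inr ParOp.irrelevance)
      {⟨.ineq, e 0, t⟩, ⟨.ineq, t, e 1⟩}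
  | .antisym =>
      let e : Fin 2 → Term all (all.vars (.inr ParOp.antisym)) .ineq := var (.inr ParOp.antisym)
      let t : Term all (all.vars (.inr ParOp.antisym)) .elem := gen (.inr ParOp.antisym)
      {⟨.elem, source (e 0), t⟩, ⟨.elem, t, source (e 1)⟩}
  | .trans =>
      let e : Fin 2 → Term all (all.vars (.inr ParOp.trans)) .ineq := var (.inr ParOp.trans)
      let t : Term all (all.vars (.inr ParOp.trans)) .ineq := gen (.inr ParOp.trans)
      {⟨.elem, source t, source (e 0)⟩, ⟨.elem, target t, target (e 1)⟩}
  | .lub => ∅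
  | .ub k =>
      let e : ℕ → Term all (all.vars (.inr (ParOp.ub k))) .ineq := var (.inr (ParOp.ub k))
      let t : Term all (all.vars (.inr (ParOp.ub k))) .ineq := gen (.inr (ParOp.ub k))
      {⟨.elem, source t, source (e k)⟩, ⟨.elem, target t, lub e⟩}
  | .least =>
      let x : Term all (all.vars (.inr ParOp.least)) .elem := var (.inr ParOp.least) (.inl ())
      let e : ℕ → Term all (all.vars (.inr ParOp.least)) .ineq :=
        fun n => var (.inr ParOp.least) (.inr (.inl n))
      let t : Term all (all.vars (.inr ParOp.least)) .ineq := gen (.inr ParOp.least)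
      {⟨.elem, source t, lub e⟩, ⟨.elem, target t, x⟩}
  | .extensionality =>
      let α : Fin 2 → Term all (all.vars (.inr ParOp.extensionality)) .rand :=
        var (.inr ParOp.extensionality)
      let t : Term all (all.vars (.inr ParOp.extensionality)) .rand :=
        gen (.inr ParOp.extensionality)
      {⟨.rand, α 0, t⟩, ⟨.rand, t, α 1⟩}
  | .rlub =>
      let e : ℕ → ℝ → Term all (all.vars (.inr ParOp.rlub)) .ineq :=
        fun n r => var (.inr ParOp.rlub) (.inr (n, r))
      let t : Term all (all.vars (.inr ParOp.rlub)) .rand := gen (.inr ParOp.rlub)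
      Set.range fun r : ℝ => ⟨.elem, ev r t, lub fun n => e n r⟩

end Equations

theorem card_srt : Cardinal.mk Srt < Order.succ Cardinal.continuum := by
  have : Finite Srt := Finite.of_injective
    (fun s : Srt => match s with | .elem => (0 : Fin 3) | .ineq => 1 | .rand => 2)
    (by rintro (_ | _ | _) (_ | _ | _) h <;> simp_all)
  exact Order.lt_succ_of_le ((Cardinal.mk_le_aleph0).trans Cardinal.aleph0_le_continuum)

theorem card_tot (o : TotOp) : Cardinal.mk (tot.Ar o) < Order.succ Cardinal.continuum := by
  refine Order.lt_succ_of_le (le_trans ?_ Cardinal.aleph0_le_continuum)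
  cases o with
  | cases p => exact Cardinal.mk_le_aleph0 (α := p.I)
  | _ => exact Cardinal.mk_le_aleph0 (α := Unit)

theorem card_par (o : ParOp) : Cardinal.mk (par.Ar o) < Order.succ Cardinal.continuum := by
  refine Order.lt_succ_of_le ?_
  cases o with
  | irrelevance | antisym | trans | extensionality =>
    exact (Cardinal.mk_le_aleph0 (α := Fin 2)).trans Cardinal.aleph0_le_continuum
  | lub | ub k => exact (Cardinal.mk_le_aleph0 (α := ℕ)).trans Cardinal.aleph0_le_continuum
  | least =>
    exact (Cardinal.mk_le_aleph0 (α := Unit ⊕ ℕ ⊕ ℕ)).trans Cardinal.aleph0_le_continuum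
  | rlub =>
    change Cardinal.mk (ℕ ⊕ ℕ × ℝ) ≤ _
    simp [Cardinal.mk_real]

end Pres

/-- The essentially algebraic presentation of ω-quasi-Borel spaces. -/
noncomputable def wqbsPres : EssAlgPres (Order.succ Cardinal.continuum) where
  Srt := Pres.Srt
  tot := Pres.tot
  par := Pres.par
  regular := Cardinal.isRegular_succ Cardinal.aleph0_le_continuum
  card_sorts := Pres.card_srt
  card_tot := Pres.card_tot
  card_par := Pres.card_par
  assum := Pres.assum
  eqs := (⋃ o : Pres.TotOp, Sigma.mk _ '' Pres.eqsTot o) ∪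
    (⋃ o : Pres.ParOp, Sigma.mk _ '' Pres.eqsPar o)

end QBorel

/-! Each of the other three categories is compared with ω-quasi-Borel spaces by a functor out of
`WQbs` that is faithful, full and essentially surjective; the equivalences are then composed.

Internal ωcpos. Membership of a generalised element in a strong subobject is a pointwise condition,
so every axiom of the internal logic can be tested on constant elements at the one-point stage.
Since the natural numbers are discrete, every sequence is a morphism out of them and a family of
sequences is random exactly when each term is (`mem_fn_nat_rand`). Hence the supremum operation is a
morphism precisely when the random elements are closed under pointwise suprema of chains, and
`mem_scott` identifies internal with external Scott continuity.

Models. The operations `irr` and `ext` are total on indistinguishable arguments and equate them, so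
inequations are pairs of elements and random elements are functions on the reals (`ineq_ext`,
`rand_ext`). The other operations say that these pairs form an ω-complete order and that these
functions form a quasi-Borel structure closed under suprema. The equations determine every operation
from sources, targets, values and least upper bounds, so a homomorphism only has to preserve those
(`homOfBasic`).

Separated sheaves. A space P gives the presheaf of P-valued random variables; it preserves countable
products because a map into a countable coproduct splits the line into countably many measurable
pieces (`isRandom_sigma`). Conversely, the points of F form the ωcpo F(1), with the sections over
the line as random elements. Product preservation gives gluing, and order reflection lifts a
pointwise chain of random elements to a chain of sections. A nonempty standard Borel space is a
retract of the line (`exists_retraction`), so what holds over the line transfers to every stage, and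
F is the sheaf of random variables in its points (`sectionIso`). -/

namespace QBorel

open QBS

/-! ### Sequences in quasi-Borel spaces -/

namespace QBS

/-- The one-point space. -/
def pt : QBS.{u} where
  carrier := PUnit
  rand := Set.univ
  const_mem _ := trivial
  comp_mem _ _ _ _ := trivial
  glue_mem _ _ _ _ _ _ _ _ := trivial

/-- The constant morphism with value `y`. -/
def Hom.const (X : QBS.{u}) {Y : QBS.{v}} (y : Y) : Hom X Y :=
  ⟨fun _ => y, fun _ _ => Y.const_mem y⟩

/-- If each `a n` is a random element, so is a countable case distinction between them. -/
theorem comp_nat_mem (X : QBS.{u}) (a : ℝ → ℕ → X) (ha : ∀ n, (fun r => a r n) ∈ X.rand)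
    {β : ℝ → ℕ} (hβ : Measurable β) : (fun r => a r (β r)) ∈ X.rand :=
  X.glue_mem (fun n => β ⁻¹' {n}) (fun n r => a r n) _
    (fun n => hβ (measurableSet_singleton n))
    (fun _ _ h => (Set.disjoint_singleton.2 h).preimage β)
    (by rw [← Set.preimage_iUnion, Set.iUnion_of_singleton, Set.preimage_univ]) ha (fun n r hr => by
      have : β r = n := hr
      rw [this])

/-- Every sequence is a morphism out of the natural numbers. -/
def seqHom {X : QBS.{u}} (a : ℕ → X) : Hom QBS.nat X :=
  ⟨a, fun _ hβ => X.comp_nat_mem (fun _ => a) (fun n => X.const_mem (a n)) hβ⟩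

/-- A measurable index takes countably many values, so evaluating at it is a case split along its
fibres. This is what turns the morphism condition on an internal supremum into closure under
pointwise suprema. -/
theorem mem_fn_nat_rand {X : QBS.{u}} (α : ℝ → Hom QBS.nat X) :
    α ∈ (fn QBS.nat X).rand ↔ ∀ n : ℕ, (fun r => (α r).toFun n) ∈ X.rand := by
  constructor
  · intro h n
    exact h _ measurable_id (fun _ => n) measurable_const
  · intro h φ hφ β hβ
    exact X.comp_nat_mem (fun r n => (α (φ r)).toFun n) (fun n => X.comp_mem _ (h n) φ hφ) hβ

end QBS

/-! ### Internal ωcpos read at points -/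

theorem mem_chains {X : QBS.{u}} (le : Subspace (X.prod X)) (a : QBS.Hom QBS.nat X) :
    a ∈ (show Set (QBS.Hom QBS.nat X) from chains le) ↔
      ∀ m n : ℕ, m ≤ n → ((a.toFun m, a.toFun n) : X × X) ∈ (show Set (X × X) from le) := by
  constructor
  · intro h m n hmn
    exact (le.holds_iff _).1 (h pt (Hom.const pt m) (Hom.const pt n)
      ((natLe.holds_iff _).2 fun _ => hmn)) PUnit.unit
  · intro h U m n hmn
    exact (le.holds_iff _).2 fun t => h _ _ ((natLe.holds_iff _).1 hmn t)

namespace IntWCpo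

variable (X : IntWCpo.{u})

/-- The external order of an internal ωcpo. -/
abbrev Le (x y : X.obj) : Prop := ((x, y) : X.obj × X.obj) ∈ (show Set (X.obj × X.obj) from X.le)

variable {X}

theorem holds_pair {U : QBS.{v}} {x y : QBS.Hom U X.obj} :
    X.le.Holds (x.pair y) ↔ ∀ t, X.Le (x t) (y t) :=
  X.le.holds_iff _

variable (X) in
theorem le_refl (x : X.obj) : X.Le x x :=
  holds_pair.1 (X.refl pt (Hom.const pt x)) PUnit.unit

theorem le_trans {x y z : X.obj} (h : X.Le x y) (h' : X.Le y z) : X.Le x z :=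
  holds_pair.1 (X.trans pt (Hom.const pt x) (Hom.const pt y) (Hom.const pt z)
    (holds_pair.2 fun _ => h) (holds_pair.2 fun _ => h')) PUnit.unit

theorem le_antisymm {x y : X.obj} (h : X.Le x y) (h' : X.Le y x) : x = y :=
  congrArg (fun k => QBS.Hom.toFun k PUnit.unit) (X.antisymm pt (Hom.const pt x) (Hom.const pt y)
    (holds_pair.2 fun _ => h) (holds_pair.2 fun _ => h'))

variable (X) in
/-- The chain of points with the given terms. -/
def mkChain (a : ℕ → X.obj) (h : ∀ m n, m ≤ n → X.Le (a m) (a n)) : (chains X.le).toQBS :=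
  ⟨seqHom a, (mem_chains X.le (seqHom a)).2 h⟩

theorem le_sup_point (a : (chains X.le).toQBS) (n : ℕ) : X.Le (a.1.toFun n) (X.sup a) :=
  holds_pair.1 (X.le_sup pt (Hom.const pt a) (Hom.const pt n)) PUnit.unit

theorem sup_le_point (a : (chains X.le).toQBS) (x : X.obj) (h : ∀ n : ℕ, X.Le (a.1.toFun n) x) :
    X.Le (X.sup a) x :=
  holds_pair.1 (X.sup_le pt (Hom.const pt a) (Hom.const pt x)
    fun _ _ n => holds_pair.2 fun t => h (n t)) PUnit.unit

/-- Constant elements at the one-point stage give the external conditions; conversely, both internal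
conditions are checked separately at each point of the stage. -/
theorem mem_scott {X Y : IntWCpo.{u}} (f : QBS.Hom X.obj Y.obj) :
    f ∈ (show Set (QBS.Hom X.obj Y.obj) from scott X Y) ↔
      (∀ x y, X.Le x y → Y.Le (f x) (f y)) ∧
      ∀ (a : (chains X.le).toQBS) (b : (chains Y.le).toQBS),
        (∀ n : ℕ, f (a.1.toFun n) = b.1.toFun n) → f (X.sup a) = Y.sup b := by
  constructor
  · rintro ⟨h₁, h₂⟩
    refine ⟨fun x y h => holds_pair.1 (h₁ pt (Hom.const pt x) (Hom.const pt y)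
      (holds_pair.2 fun _ => h)) PUnit.unit, fun a b h => ?_⟩
    exact congrArg (fun k => QBS.Hom.toFun k PUnit.unit)
      (h₂ pt (Hom.const pt a) (Hom.const pt b)
        (QBS.Hom.ext (funext fun _ => QBS.Hom.ext (funext h))))
  · rintro ⟨h₁, h₂⟩
    refine ⟨fun U x y h => holds_pair.2 fun t => h₁ _ _ (holds_pair.1 h t), fun U a b h => ?_⟩
    refine QBS.Hom.ext (funext fun t => h₂ (a t) (b t) fun n => ?_)
    exact congrArg (fun k => QBS.Hom.toFun (QBS.Hom.toFun k t) n) h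

variable (X) in
/-- The external partial order of an internal ωcpo. -/
abbrev partialOrder : PartialOrder X.obj where
  le := X.Le
  le_refl := X.le_refl
  le_trans _ _ _ := le_trans
  le_antisymm _ _ := le_antisymm

variable (X) in
/-- The external ωcpo of an internal ωcpo. -/
abbrev omegaCompletePartialOrder : OmegaCompletePartialOrder X.obj where
  toPartialOrder := X.partialOrder
  ωSup c :=
    letI := X.partialOrder
    X.sup (X.mkChain c fun _ _ h => c.monotone' h)
  le_ωSup c n :=
    letI := X.partialOrder
    le_sup_point (X.mkChain c fun _ _ h => c.monotone' h) n
  ωSup_le c x h :=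
    letI := X.partialOrder
    sup_le_point (X.mkChain c fun _ _ h => c.monotone' h) x h

variable (X) in
/-- The ω-quasi-Borel space of an internal ωcpo. -/
def toWQbs : WQbs.{u} where
  toQBS := X.obj
  str := X.omegaCompletePartialOrder
  sup_mem c hc := by
    let := X.partialOrder
    -- The chains `c · r`, indexed by `r`, form a random element of the space of chains because each
    -- term does; the morphism `sup` sends it to the pointwise supremum.
    exact X.sup.map_rand
      (fun r => X.mkChain (fun n => c n r) fun m n h => c.monotone' h r)
      ((mem_fn_nat_rand fun r => seqHom fun n => c n r).2 hc)

end IntWCpo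

/-! ### Equivalence with internal ωcpos -/

namespace WQbs

/-- The internal order of an ω-quasi-Borel space. -/
def leSub (P : WQbs.{u}) : Subspace (P.toQBS.prod P.toQBS) :=
  {p : P.carrier × P.carrier | p.1 ≤ p.2}

theorem holds_leSub {P : WQbs.{u}} {U : QBS.{v}} {x y : QBS.Hom U P.toQBS} :
    P.leSub.Holds (x.pair y) ↔ ∀ t, (show P.carrier from x t) ≤ y t :=
  P.leSub.holds_iff _

/-- A point of the space of internal chains is a chain. -/
def toChain {P : WQbs.{u}} (a : (chains P.leSub).toQBS) : Chain P.carrier :=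
  ⟨⟨a.1.toFun, fun m n h => (mem_chains P.leSub a.1).1 a.2 m n h⟩⟩

/-- The internal ωcpo of an ω-quasi-Borel space. -/
def toIntObj (P : WQbs.{u}) : IntWCpo.{u} where
  obj := P.toQBS
  le := P.leSub
  refl _ _ := holds_leSub.2 fun _ => le_rfl
  antisymm _ _ _ h h' :=
    QBS.Hom.ext (funext fun t => le_antisymm (holds_leSub.1 h t) (holds_leSub.1 h' t))
  trans _ _ _ _ h h' := holds_leSub.2 fun t => (holds_leSub.1 h t).trans (holds_leSub.1 h' t)
  sup := ⟨fun a => ωSup (toChain a), fun α hα =>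
    P.sup_mem ⟨⟨fun n r => (α r).1.toFun n,
      fun m n h r => (mem_chains P.leSub (α r).1).1 (α r).2 m n h⟩⟩
      ((mem_fn_nat_rand fun r => (α r).1).1 hα)⟩
  le_sup _ a n := holds_leSub.2 fun t => le_ωSup (toChain (a t)) (n t)
  -- The upper bound hypothesis ranges over all later stages; the one-point stage mapped to `t`,
  -- with a constant index, already suffices.
  sup_le _ a _ h := holds_leSub.2 fun t => ωSup_le (toChain (a t)) _ fun n =>
    holds_leSub.1 (h pt (Hom.const pt t) (Hom.const pt n)) PUnit.unit

theorem mem_scott_toIntObj {P Q : WQbs.{u}} (f : QBS.Hom P.toQBS Q.toQBS) :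
    f ∈ (show Set (QBS.Hom P.toIntObj.obj Q.toIntObj.obj) from
        IntWCpo.scott P.toIntObj Q.toIntObj) ↔
      ∃ h : Monotone (f.toFun : P.carrier → Q.carrier), ∀ c : Chain P.carrier,
        f.toFun (ωSup c) = ωSup (c.map ⟨f.toFun, h⟩) := by
  refine (IntWCpo.mem_scott (X := P.toIntObj) (Y := Q.toIntObj) f).trans ?_
  constructor
  · rintro ⟨h₁, h₂⟩
    have hm : Monotone (f.toFun : P.carrier → Q.carrier) := fun x y h => h₁ x y h
    refine ⟨hm, fun c => ?_⟩
    exact h₂ (P.toIntObj.mkChain c.toFun fun _ _ h => c.monotone' h)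
      (Q.toIntObj.mkChain (fun n => f.toFun (c n)) fun _ _ h => hm (c.monotone' h))
      fun _ => rfl
  · rintro ⟨h₁, h₂⟩
    refine ⟨fun x y h => h₁ h, fun a b h => (h₂ (toChain a)).trans ?_⟩
    exact congrArg ωSup (Chain.ext (funext h))

/-- The functor from ω-quasi-Borel spaces to internal ωcpos. -/
def toInt : WQbs.{u} ⥤ IntWCpo.{u} where
  obj := toIntObj
  map f := ⟨⟨f.toFun, f.map_rand⟩, (mem_scott_toIntObj _).2 ⟨f.monotone', f.map_ωSup'⟩⟩
  map_id _ := rfl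
  map_comp _ _ := rfl

instance : toInt.{u}.Faithful where
  map_injective {P Q} f g h := by
    have : f.toFun = g.toFun := congrArg (fun k => (Subtype.val k).toFun) h
    exact WQbs.Hom.ext this

instance : toInt.{u}.Full where
  map_surjective {P Q} f := by
    obtain ⟨h₁, h₂⟩ := (mem_scott_toIntObj f.1).1 f.2
    exact ⟨⟨⟨⟨f.1.toFun, h₁⟩, h₂⟩, f.1.map_rand⟩, rfl⟩

instance : toInt.{u}.EssSurj where
  mem_essImage X := by
    -- Carrier, random elements and order are unchanged by the round trip. Only the suprema need
    -- comparison, and they agree because a point of the space of chains is determined by its terms.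
    refine ⟨X.toWQbs, ⟨⟨⟨QBS.Hom.id _, ?_⟩, ⟨QBS.Hom.id _, ?_⟩, rfl, rfl⟩⟩⟩
    · exact (IntWCpo.mem_scott _).2 ⟨fun x y h => h, fun a b h =>
        congrArg X.sup (Subtype.ext (QBS.Hom.ext (funext h)))⟩
    · exact (IntWCpo.mem_scott _).2 ⟨fun x y h => h, fun a b h =>
        congrArg X.sup (Subtype.ext (QBS.Hom.ext (funext h)))⟩

/-- ω-quasi-Borel spaces are the same as internal ωcpos. -/
noncomputable def equivInt : WQbs.{u} ≌ IntWCpo.{u} :=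
  haveI : toInt.{u}.IsEquivalence := {}
  toInt.asEquivalence

end WQbs
-- Terms and homomorphisms over an essentially algebraic presentation
namespace PartialAlgebra

variable {κ : Cardinal.{0}} {P : EssAlgPres κ} (A : PartialAlgebra.{u} P)

/-- The two sides of `e` agree whenever both are defined. -/
def SatAt {V : P.Srt → Type} (v : ∀ s, V s → A.carrier s) (e : Eqn (P.tot.sum P.par) V) : Prop :=
  ∀ x ∈ A.eval v e.lhs, ∀ y ∈ A.eval v e.rhs, x = y

variable {A}

theorem mem_eval_op {V : P.Srt → Type} {v : ∀ s, V s → A.carrier s} {o : (P.tot.sum P.par).Op}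
    {t : ∀ i, Term (P.tot.sum P.par) V ((P.tot.sum P.par).arg o i)}
    {x : A.carrier ((P.tot.sum P.par).res o)} :
    x ∈ A.eval v (.op o t) ↔ ∃ a, (∀ i, a i ∈ A.eval v (t i)) ∧ x ∈ A.op o a := by
  rw [eval, Part.mem_bind_iff]
  constructor
  · rintro ⟨a, ⟨h, rfl⟩, hx⟩
    exact ⟨_, fun i => Part.get_mem _, hx⟩
  · rintro ⟨a, ha, hx⟩
    exact ⟨a, ⟨fun i => (ha i).1, funext fun i => (ha i).2⟩, hx⟩

theorem eval_op_eq {V : P.Srt → Type} {v : ∀ s, V s → A.carrier s} {o : (P.tot.sum P.par).Op}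
    {t : ∀ i, Term (P.tot.sum P.par) V ((P.tot.sum P.par).arg o i)}
    {a : ∀ i, A.carrier ((P.tot.sum P.par).arg o i)} (h : ∀ i, A.eval v (t i) = Part.some (a i)) :
    A.eval v (.op o t) = A.op o a := by
  ext x
  rw [mem_eval_op]
  constructor
  · rintro ⟨b, hb, hx⟩
    have : b = a := funext fun i => Part.mem_some_iff.1 (h i ▸ hb i)
    exact this ▸ hx
  · exact fun hx => ⟨a, fun i => h i ▸ Part.mem_some _, hx⟩

/-- The valuation of the variables of an operation of the combined signature. -/
def valuationAll {o : (P.tot.sum P.par).Op} (a : ∀ i, A.carrier ((P.tot.sum P.par).arg o i))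
    (s : P.Srt) (x : (P.tot.sum P.par).vars o s) : A.carrier s :=
  x.2 ▸ a x.1

/-- The variables of an operation are its argument positions, so equations in these variables are
laws about argument tuples. -/
theorem exists_eq_valuationAll {o : (P.tot.sum P.par).Op}
    (v : ∀ s, (P.tot.sum P.par).vars o s → A.carrier s) :
    ∃ a : ∀ i, A.carrier ((P.tot.sum P.par).arg o i), v = valuationAll a := by
  refine ⟨fun i => v _ ⟨i, rfl⟩, ?_⟩
  funext s x
  obtain ⟨i, rfl⟩ := x
  rfl

theorem evalTot_natural {A B : PartialAlgebra.{u} P} (g : ∀ s, A.carrier s → B.carrier s)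
    (hg : ∀ (o : P.tot.Op) (a : ∀ i, A.carrier (P.tot.arg o i)),
      g _ (A.tot o a) = B.tot o fun i => g _ (a i))
    {V : P.Srt → Type} (v : ∀ s, V s → A.carrier s) {s : P.Srt} (t : Term P.tot V s) :
    g s (A.evalTot v t) = B.evalTot (fun s x => g s (v s x)) t := by
  induction t with
  | var x => rfl
  | op o t ih =>
    refine (hg o _).trans (congrArg (B.tot o) (funext fun i => ih i))

theorem valuation_natural {A B : PartialAlgebra.{u} P} (g : ∀ s, A.carrier s → B.carrier s)
    {o : P.par.Op} (a : ∀ i, A.carrier (P.par.arg o i)) :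
    (fun s x => g s (A.valuation a s x)) = B.valuation (fun i => g _ (a i)) := by
  funext s x
  obtain ⟨i, rfl⟩ := x
  rfl

end PartialAlgebra

namespace Model

variable {κ : Cardinal.{0}} {P : EssAlgPres κ} {A B : Model.{u} P}

/-- Assumptions are equations between total terms, and maps that commute with the total operations
preserve such equations. Definedness in the target is therefore never an extra obligation. -/
theorem dom_of_map (g : ∀ s, A.carrier s → B.carrier s)
    (hg : ∀ (o : P.tot.Op) (a : ∀ i, A.carrier (P.tot.arg o i)),
      g _ (A.tot o a) = B.tot o fun i => g _ (a i))
    (o : P.par.Op) (a : ∀ i, A.carrier (P.par.arg o i)) (h : (A.par o a).Dom) :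
    (B.par o fun i => g _ (a i)).Dom := by
  rw [B.dom_iff]
  intro e he
  rw [← PartialAlgebra.valuation_natural g a, ← PartialAlgebra.evalTot_natural g hg,
    ← PartialAlgebra.evalTot_natural g hg, (A.dom_iff o a).1 h e he]

/-- Injectivity reflects the equations that constitute the assumptions. This is what makes the
inverse of a bijective homomorphism respect partial operations. -/
theorem dom_of_map_injective (f : Hom A B) (hf : ∀ s, Function.Injective (f.map s))
    (o : P.par.Op) (a : ∀ i, A.carrier (P.par.arg o i))
    (h : (B.par o fun i => f.map _ (a i)).Dom) : (A.par o a).Dom := by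
  rw [A.dom_iff]
  intro e he
  apply hf
  rw [PartialAlgebra.evalTot_natural f.map f.map_tot,
    PartialAlgebra.evalTot_natural f.map f.map_tot,
    PartialAlgebra.valuation_natural (A := A.toPartialAlgebra) (B := B.toPartialAlgebra)]
  exact (B.dom_iff o _).1 h e he

/-- A bijective homomorphism is an isomorphism. -/
noncomputable def isoOfBijective (f : Hom A B) (hf : ∀ s, Function.Bijective (f.map s)) : A ≅ B :=
  let g s := Function.surjInv (hf s).2
  have hfg : ∀ s y, f.map s (g s y) = y := fun s => Function.surjInv_eq (hf s).2
  have hgf : ∀ s x, g s (f.map s x) = x := fun s => Function.leftInverse_surjInv (hf s)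
  { hom := f
    inv :=
      { map := g
        map_tot := fun o a => (hf _).1 (by
          rw [hfg, f.map_tot]
          simp only [hfg])
        map_par := fun o a x hx => by
          have ha : (fun i => f.map _ (g _ (a i))) = a := funext fun i => hfg _ _
          have hd := dom_of_map_injective f (fun s => (hf s).1) o (fun i => g _ (a i))
            (by rw [ha]; exact hx.1)
          have hm := f.map_par o _ _ (Part.get_mem hd)
          rw [ha] at hm
          have := Part.mem_unique hx hm
          rw [this, hgf]
          exact Part.get_mem hd }
    hom_inv_id := Hom.ext (funext fun s => funext fun x => hgf s x)
    inv_hom_id := Hom.ext (funext fun s => funext fun x => hfg s x) }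

end Model

/-! ### The presentation unfolded into laws on algebras -/

namespace Pres

open PartialAlgebra

variable (A : PartialAlgebra.{u} wqbsPres)

/-- The elements of a partial algebra. -/
abbrev Elem : Type u := A.carrier Srt.elem

/-- The inequations of a partial algebra. -/
abbrev Ineq : Type u := A.carrier Srt.ineq

/-- The random elements of a partial algebra. -/
abbrev Rand : Type u := A.carrier Srt.rand

variable {A}

/-- The source of an inequation. -/
def src (e : Ineq A) : Elem A := A.tot TotOp.source fun _ => e

/-- The target of an inequation. -/
def tgt (e : Ineq A) : Elem A := A.tot TotOp.target fun _ => e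

/-- The value of a random element. -/
def val (r : ℝ) (α : Rand A) : Elem A := A.tot (TotOp.ev r) fun _ => α

theorem forall_mem_singleton {α : Type v} {p : α → Prop} {a : α} :
    (∀ x ∈ ({a} : Set α), p x) ↔ p a := by
  simp

theorem forall_mem_union {α : Type v} {p : α → Prop} {s t : Set α} :
    (∀ x ∈ s ∪ t, p x) ↔ (∀ x ∈ s, p x) ∧ ∀ x ∈ t, p x := by
  simp only [Set.mem_union, or_imp, forall_and]

/-- The assumptions of the partial operations, in terms of the algebra. -/
def DomCond : (o : ParOp) → (∀ i : par.Ar o, A.carrier (par.arg o i)) → Prop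
  | .irrelevance, (a : Fin 2 → Ineq A) => src (a 0) = src (a 1) ∧ tgt (a 0) = tgt (a 1)
  | .antisym, (a : Fin 2 → Ineq A) => src (a 0) = tgt (a 1) ∧ tgt (a 0) = src (a 1)
  | .trans, (a : Fin 2 → Ineq A) => tgt (a 0) = src (a 1)
  | .lub, (a : ℕ → Ineq A) => ∀ n, tgt (a n) = src (a (n + 1))
  | .ub _, (a : ℕ → Ineq A) => ∀ n, tgt (a n) = src (a (n + 1))
  | .least, a =>
      let x : Elem A := a (.inl ())
      let e : ℕ → Ineq A := fun n => a (.inr (.inl n))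
      let b : ℕ → Ineq A := fun n => a (.inr (.inr n))
      ((∀ n, tgt (e n) = src (e (n + 1))) ∧ ∀ n, tgt (b n) = x) ∧ ∀ n, src (e n) = src (b n)
  | .extensionality, (a : Fin 2 → Rand A) => ∀ r, val r (a 0) = val r (a 1)
  | .rlub, a =>
      let α : ℕ → Rand A := fun n => a (.inl n)
      let e : ℕ → ℝ → Ineq A := fun n r => a (.inr (n, r))
      (∀ p : ℕ × ℝ, src (e p.1 p.2) = val p.2 (α p.1)) ∧
        ∀ p : ℕ × ℝ, tgt (e p.1 p.2) = val p.2 (α (p.1 + 1))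

theorem assum_iff (o : ParOp) (a : ∀ i : par.Ar o, A.carrier (par.arg o i)) :
    (∀ e ∈ wqbsPres.assum o, A.evalTot (A.valuation (o := o) a) e.lhs =
      A.evalTot (A.valuation (o := o) a) e.rhs) ↔ DomCond o a := by
  cases o with
  | irrelevance | antisym =>
    exact Set.forall_mem_insert.trans (and_congr Iff.rfl forall_mem_singleton)
  | trans => exact forall_mem_singleton
  | lub | ub k => exact Set.forall_mem_range
  | least =>
    exact forall_mem_union.trans (and_congr (forall_mem_union.trans
      (and_congr Set.forall_mem_range Set.forall_mem_range)) Set.forall_mem_range)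
  | extensionality => exact Set.forall_mem_range
  | rlub =>
    exact forall_mem_union.trans (and_congr Set.forall_mem_range Set.forall_mem_range)

/-- The equations for the total operations, in terms of the algebra. -/
def LawTot : (o : TotOp) → (∀ i : tot.Ar o, A.carrier (tot.arg o i)) → Prop
  | .refl, (a : Unit → Elem A) =>
      src (A.tot TotOp.refl a) = a () ∧ a () = tgt (A.tot TotOp.refl a)
  | .const, (a : Unit → Elem A) => ∀ r, val r (A.tot TotOp.const a) = a ()
  | .rearrange φ, (a : Unit → Rand A) =>
      ∀ r, val r (A.tot (TotOp.rearrange φ) a) = val (φ.1 r) (a ())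
  | .cases p, (a : p.I → Rand A) =>
      ∀ q : (Σ i : p.I, p.S i), val q.2.1 (A.tot (TotOp.cases p) a) = val q.2.1 (a q.1)
  | _, _ => True

/-- The equations for the partial operations, in terms of the algebra. -/
def LawPar : (o : ParOp) → (∀ i : par.Ar o, A.carrier (par.arg o i)) → Prop
  | .irrelevance, (a : Fin 2 → Ineq A) =>
      ∀ e ∈ A.par ParOp.irrelevance a, a 0 = e ∧ e = a 1
  | .antisym, (a : Fin 2 → Ineq A) =>
      ∀ x ∈ A.par ParOp.antisym a, src (a 0) = x ∧ x = src (a 1)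
  | .trans, (a : Fin 2 → Ineq A) =>
      ∀ e ∈ A.par ParOp.trans a, src e = src (a 0) ∧ tgt e = tgt (a 1)
  | .lub, _ => True
  | .ub k, (a : ℕ → Ineq A) => ∀ e ∈ A.par (ParOp.ub k) a,
      src e = src (a k) ∧ ∀ y ∈ A.par ParOp.lub a, tgt e = y
  | .least, a => ∀ e ∈ A.par ParOp.least a,
      (∀ y ∈ A.par ParOp.lub (fun n => a (.inr (.inl n))), src e = y) ∧ tgt e = a (.inl ())
  | .extensionality, (a : Fin 2 → Rand A) =>
      ∀ α ∈ A.par ParOp.extensionality a, a 0 = α ∧ α = a 1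
  | .rlub, a => ∀ α ∈ A.par ParOp.rlub a, ∀ r,
      ∀ y ∈ A.par ParOp.lub (fun n => a (.inr (n, r))), val r α = y

section Eval

variable {V : Srt → Type} {v : ∀ s, V s → A.carrier s}

theorem eval_source {t : Term all V .ineq} {e : Ineq A} (h : A.eval v t = Part.some e) :
    A.eval v (source t) = Part.some (src e) :=
  eval_op_eq (P := wqbsPres) (o := .inl TotOp.source) (a := fun _ => e) fun _ => h

theorem eval_target {t : Term all V .ineq} {e : Ineq A} (h : A.eval v t = Part.some e) :
    A.eval v (target t) = Part.some (tgt e) :=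
  eval_op_eq (P := wqbsPres) (o := .inl TotOp.target) (a := fun _ => e) fun _ => h

theorem eval_ev {r : ℝ} {t : Term all V .rand} {α : Rand A} (h : A.eval v t = Part.some α) :
    A.eval v (ev r t) = Part.some (val r α) :=
  eval_op_eq (P := wqbsPres) (o := .inl (TotOp.ev r)) (a := fun _ => α) fun _ => h

/-- This form serves arguments headed by a partial operation, whose value may be undefined. -/
theorem eval_source_map {t : Term all V .ineq} {p : Part (Ineq A)} (h : A.eval v t = p) :
    A.eval v (source t) = p.map src := by
  subst h
  exact Part.ext fun x => (mem_eval_op (P := wqbsPres) (o := .inl TotOp.source)).trans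
    ⟨fun ⟨a, ha, hx⟩ => Part.mem_map_iff _ |>.2 ⟨a (), ha (), (Part.mem_some_iff.1 hx).symm⟩,
      fun hx => let ⟨e, he, hx⟩ := (Part.mem_map_iff _).1 hx
        ⟨fun _ => e, fun _ => he, Part.mem_some_iff.2 hx.symm⟩⟩

theorem eval_target_map {t : Term all V .ineq} {p : Part (Ineq A)} (h : A.eval v t = p) :
    A.eval v (target t) = p.map tgt := by
  subst h
  exact Part.ext fun x => (mem_eval_op (P := wqbsPres) (o := .inl TotOp.target)).trans
    ⟨fun ⟨a, ha, hx⟩ => Part.mem_map_iff _ |>.2 ⟨a (), ha (), (Part.mem_some_iff.1 hx).symm⟩,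
      fun hx => let ⟨e, he, hx⟩ := (Part.mem_map_iff _).1 hx
        ⟨fun _ => e, fun _ => he, Part.mem_some_iff.2 hx.symm⟩⟩

theorem eval_ev_map {r : ℝ} {t : Term all V .rand} {p : Part (Rand A)} (h : A.eval v t = p) :
    A.eval v (ev r t) = p.map (val r) := by
  subst h
  exact Part.ext fun x => (mem_eval_op (P := wqbsPres) (o := .inl (TotOp.ev r))).trans
    ⟨fun ⟨a, ha, hx⟩ => Part.mem_map_iff _ |>.2 ⟨a (), ha (), (Part.mem_some_iff.1 hx).symm⟩,
      fun hx => let ⟨e, he, hx⟩ := (Part.mem_map_iff _).1 hx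
        ⟨fun _ => e, fun _ => he, Part.mem_some_iff.2 hx.symm⟩⟩

theorem eval_lub {t : ℕ → Term all V .ineq} {e : ℕ → Ineq A}
    (h : ∀ n, A.eval v (t n) = Part.some (e n)) : A.eval v (lub t) = A.par ParOp.lub e :=
  eval_op_eq (P := wqbsPres) (o := .inr ParOp.lub) h

theorem eval_var {o : all.Op} {a : ∀ i, A.carrier (all.arg o i)} (i : all.Ar o) :
    A.eval (valuationAll (P := wqbsPres) (o := o) a) (var o i) = Part.some (a i) :=
  rfl

theorem eval_gen {o : all.Op} {a : ∀ i, A.carrier (all.arg o i)} :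
    A.eval (valuationAll (P := wqbsPres) (o := o) a) (gen o) = A.op o a :=
  eval_op_eq fun _ => rfl

variable {s : Srt} {l r : Term all V s}

/-- This lemma and the four after it are distinguished by which side of the equation may be
undefined; satisfaction constrains only the case in which both sides have values. -/
theorem satAt_some {x y : A.carrier s} (hl : A.eval v l = Part.some x)
    (hr : A.eval v r = Part.some y) : A.SatAt v ⟨s, l, r⟩ ↔ x = y := by
  unfold SatAt
  constructor
  · exact fun h => h x (hl ▸ Part.mem_some x) y (hr ▸ Part.mem_some y)
  · rintro rfl x' hx y' hy
    exact Part.mem_unique (hl ▸ hx : x' ∈ Part.some x) (hr ▸ hy : y' ∈ Part.some x)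

theorem satAt_map {E : Type v} {f : E → A.carrier s} {p : Part E} {q : Part (A.carrier s)}
    (hl : A.eval v l = p.map f) (hr : A.eval v r = q) :
    A.SatAt v ⟨s, l, r⟩ ↔ ∀ e ∈ p, ∀ y ∈ q, f e = y := by
  unfold SatAt
  constructor
  · exact fun h e he y hy => h (f e) (hl ▸ Part.mem_map f he) y (hr ▸ hy)
  · intro h x hx y hy
    obtain ⟨e, he, rfl⟩ := (Part.mem_map_iff f).1 (hl ▸ hx : x ∈ p.map f)
    exact h e he y (hr ▸ hy)

theorem satAt_map_some {E : Type v} {f : E → A.carrier s} {p : Part E} {y : A.carrier s}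
    (hl : A.eval v l = p.map f) (hr : A.eval v r = Part.some y) :
    A.SatAt v ⟨s, l, r⟩ ↔ ∀ e ∈ p, f e = y :=
  (satAt_map hl hr).trans (forall₂_congr fun _ _ =>
    ⟨fun h => h y (Part.mem_some y), fun h _ hy => h.trans (Part.mem_some_iff.1 hy).symm⟩)

theorem satAt_part_some {p : Part (A.carrier s)} {y : A.carrier s}
    (hl : A.eval v l = p) (hr : A.eval v r = Part.some y) :
    A.SatAt v ⟨s, l, r⟩ ↔ ∀ e ∈ p, e = y :=
  satAt_map_some (f := fun e => e) (hl.trans (Part.map_id' (fun _ => rfl) p).symm) hr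

theorem satAt_some_part {p : Part (A.carrier s)} {y : A.carrier s}
    (hl : A.eval v l = Part.some y) (hr : A.eval v r = p) :
    A.SatAt v ⟨s, l, r⟩ ↔ ∀ e ∈ p, y = e :=
  (satAt_map (f := fun e => e) (hl.trans (Part.map_id' (fun _ => rfl) _).symm) hr).trans
    ⟨fun h => h y (Part.mem_some y), fun h _ hy => Part.mem_some_iff.1 hy ▸ h⟩

end Eval

theorem satAt_eqsTot (o : TotOp) (a : ∀ i, A.carrier (tot.arg o i)) :
    (∀ e ∈ eqsTot o, A.SatAt (valuationAll (P := wqbsPres) (o := .inl o) a) e) ↔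
      LawTot o a := by
  cases o with
  | source | target | ev r => exact ⟨fun _ => trivial, fun _ e he => he.elim⟩
  | refl =>
    exact Set.forall_mem_insert.trans (and_congr (satAt_some (eval_source eval_gen) rfl)
      (forall_mem_singleton.trans (satAt_some rfl (eval_target eval_gen))))
  | const =>
    exact Set.forall_mem_range.trans (forall_congr' fun r => satAt_some (eval_ev eval_gen) rfl)
  | rearrange φ =>
    exact Set.forall_mem_range.trans
      (forall_congr' fun r => satAt_some (eval_ev eval_gen) (eval_ev rfl))
  | cases p =>
    exact Set.forall_mem_range.trans
      (forall_congr' fun q => satAt_some (eval_ev eval_gen) (eval_ev rfl))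

theorem satAt_eqsPar (o : ParOp) (a : ∀ i, A.carrier (par.arg o i)) :
    (∀ e ∈ eqsPar o, A.SatAt (valuationAll (P := wqbsPres) (o := .inr o) a) e) ↔
      LawPar o a := by
  cases o with
  | lub => exact ⟨fun _ => trivial, fun _ e he => he.elim⟩
  | irrelevance =>
    exact (Set.forall_mem_insert.trans (and_congr (satAt_some_part rfl eval_gen)
      (forall_mem_singleton.trans (satAt_part_some eval_gen rfl)))).trans forall₂_and.symm
  | antisym =>
    exact (Set.forall_mem_insert.trans (and_congr (satAt_some_part
        (eval_source (eval_var (o := .inr ParOp.antisym) (a := a) (0 : Fin 2))) eval_gen)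
      (forall_mem_singleton.trans (satAt_part_some eval_gen
        (eval_source (eval_var (o := .inr ParOp.antisym) (a := a) (1 : Fin 2))))))).trans
      forall₂_and.symm
  | trans =>
    exact (Set.forall_mem_insert.trans (and_congr
      (satAt_map_some (eval_source_map eval_gen) (eval_source rfl))
      (forall_mem_singleton.trans
        (satAt_map_some (eval_target_map eval_gen) (eval_target rfl))))).trans forall₂_and.symm
  | ub k =>
    exact (Set.forall_mem_insert.trans (and_congr
      (satAt_map_some (eval_source_map eval_gen) (eval_source rfl))
      (forall_mem_singleton.trans
        (satAt_map (eval_target_map eval_gen) (eval_lub fun _ => rfl))))).trans forall₂_and.symm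
  | least =>
    exact (Set.forall_mem_insert.trans (and_congr
      (satAt_map (eval_source_map eval_gen) (eval_lub fun _ => rfl))
      (forall_mem_singleton.trans
        (satAt_map_some (eval_target_map eval_gen) rfl)))).trans forall₂_and.symm
  | extensionality =>
    exact (Set.forall_mem_insert.trans (and_congr (satAt_some_part rfl eval_gen)
      (forall_mem_singleton.trans (satAt_part_some eval_gen rfl)))).trans forall₂_and.symm
  | rlub =>
    refine Set.forall_mem_range.trans (Iff.trans
      (forall_congr' fun r => satAt_map (eval_ev_map eval_gen) (eval_lub fun n =>
        eval_var (o := .inr ParOp.rlub) (a := a) (.inr (n, r)))) ?_)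
    exact ⟨fun h α hα r => h r α hα, fun h r α hα => h α hα r⟩

/-- Each equation is stated over the variables of one operation, and a valuation of these is a tuple
of arguments; the claim then follows operation by operation. -/
theorem sat_iff :
    (∀ e ∈ wqbsPres.eqs, ∀ v : (∀ s, e.1 s → A.carrier s), A.SatAt v e.2) ↔
      (∀ o (a : ∀ i, A.carrier (tot.arg o i)), LawTot o a) ∧
      ∀ o (a : ∀ i, A.carrier (par.arg o i)), LawPar o a := by
  constructor
  · intro h
    exact ⟨fun o a => (satAt_eqsTot o a).1 fun e he =>
        h ⟨_, e⟩ (.inl (Set.mem_iUnion.2 ⟨o, e, he, rfl⟩)) _,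
      fun o a => (satAt_eqsPar o a).1 fun e he =>
        h ⟨_, e⟩ (.inr (Set.mem_iUnion.2 ⟨o, e, he, rfl⟩)) _⟩
  · rintro ⟨h₁, h₂⟩ e (he | he) v
    · obtain ⟨o, e, he', rfl⟩ := Set.mem_iUnion.1 he
      obtain ⟨a, rfl⟩ := exists_eq_valuationAll (P := wqbsPres) (o := .inl o) v
      exact (satAt_eqsTot o a).2 (h₁ o a) e he'
    · obtain ⟨o, e, he', rfl⟩ := Set.mem_iUnion.1 he
      obtain ⟨a, rfl⟩ := exists_eq_valuationAll (P := wqbsPres) (o := .inr o) v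
      exact (satAt_eqsPar o a).2 (h₂ o a) e he'

end Pres
-- Homomorphisms from sources, targets, values and least upper bounds
namespace Pres

open PartialAlgebra

section Laws

variable (A : Model.{u} wqbsPres)

theorem lawTot (o : TotOp) (a : ∀ i, A.carrier (tot.arg o i)) : LawTot o a :=
  (sat_iff.1 A.sat).1 o a

theorem lawPar (o : ParOp) (a : ∀ i, A.carrier (par.arg o i)) : LawPar o a :=
  (sat_iff.1 A.sat).2 o a

theorem dom_iff_domCond (o : ParOp) (a : ∀ i, A.carrier (par.arg o i)) :
    (A.par o a).Dom ↔ DomCond o a :=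
  (A.dom_iff o a).trans (assum_iff o a)

variable {A}

theorem exists_mem_par {o : ParOp} {a : ∀ i, A.carrier (par.arg o i)} (h : DomCond o a) :
    ∃ x, x ∈ A.par o a :=
  Part.dom_iff_mem.1 ((dom_iff_domCond A o a).2 h)

/-- The assumptions of `irr` hold for the two inequations, so its value exists, and the equations
identify it with both. -/
theorem ineq_ext {e e' : Ineq A.toPartialAlgebra} (hs : src e = src e') (ht : tgt e = tgt e') :
    e = e' := by
  obtain ⟨x, hx⟩ := exists_mem_par (A := A) (o := .irrelevance)
    (a := fun i : Fin 2 => if i = 0 then e else e') ⟨hs, ht⟩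
  have h := lawPar A .irrelevance _ x hx
  exact h.1.trans h.2

/-- The same argument with `ext`: its value exists and equals both random elements. -/
theorem rand_ext {α β : Rand A.toPartialAlgebra} (h : ∀ r, val r α = val r β) : α = β := by
  obtain ⟨x, hx⟩ := exists_mem_par (A := A) (o := .extensionality)
    (a := fun i : Fin 2 => if i = 0 then α else β) h
  have h := lawPar A .extensionality _ x hx
  exact h.1.trans h.2

end Laws

/-- A family of maps that preserves sources, targets and values of random elements preserves all
total operations. -/
theorem map_tot_of_basic {A B : Model.{u} wqbsPres} (g : ∀ s : Srt, A.carrier s → B.carrier s)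
    (hs : ∀ e : Ineq A.toPartialAlgebra,
      g .elem (src e) = src (A := B.toPartialAlgebra) (g .ineq e))
    (ht : ∀ e : Ineq A.toPartialAlgebra,
      g .elem (tgt e) = tgt (A := B.toPartialAlgebra) (g .ineq e))
    (hv : ∀ r (α : Rand A.toPartialAlgebra),
      g .elem (val r α) = val (A := B.toPartialAlgebra) r (g .rand α))
    (o : TotOp) (a : ∀ i, A.carrier (tot.arg o i)) :
    g _ (A.tot o a) = B.tot o fun i => g _ (a i) := by
  cases o with
  | source => exact hs (a ())
  | target => exact ht (a ())
  | ev r => exact hv r (a ())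
  | refl =>
    have hA := lawTot A .refl a
    have hB := lawTot B .refl fun i => g _ (a i)
    exact ineq_ext ((hs _).symm.trans ((congrArg _ hA.1).trans hB.1.symm))
      ((ht _).symm.trans ((congrArg _ hA.2.symm).trans hB.2))
  | const =>
    have hA := lawTot A .const a
    have hB := lawTot B .const fun i => g _ (a i)
    exact rand_ext fun r => (hv r _).symm.trans ((congrArg _ (hA r)).trans (hB r).symm)
  | rearrange φ =>
    have hA := lawTot A (.rearrange φ) a
    have hB := lawTot B (.rearrange φ) fun i => g _ (a i)
    exact rand_ext fun r => (hv r _).symm.trans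
      ((congrArg _ (hA r)).trans ((hv _ _).trans (hB r).symm))
  | cases p =>
    have hA := lawTot A (.cases p) a
    have hB := lawTot B (.cases p) fun i => g _ (a i)
    refine rand_ext fun r => ?_
    obtain ⟨i, hi⟩ := Set.mem_iUnion.1 (p.cover ▸ Set.mem_univ r)
    exact (hv r _).symm.trans
      ((congrArg _ (hA ⟨i, r, hi⟩)).trans ((hv _ _).trans (hB ⟨i, r, hi⟩).symm))

/-- A family of maps that preserves sources, targets, values of random elements, and least upper
bounds, is a homomorphism of models. -/
noncomputable def homOfBasic {A B : Model.{u} wqbsPres} (g : ∀ s : Srt, A.carrier s → B.carrier s)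
    (hs : ∀ e : Ineq A.toPartialAlgebra,
      g .elem (src e) = src (A := B.toPartialAlgebra) (g .ineq e))
    (ht : ∀ e : Ineq A.toPartialAlgebra,
      g .elem (tgt e) = tgt (A := B.toPartialAlgebra) (g .ineq e))
    (hv : ∀ r (α : Rand A.toPartialAlgebra),
      g .elem (val r α) = val (A := B.toPartialAlgebra) r (g .rand α))
    (hl : ∀ (e : ℕ → Ineq A.toPartialAlgebra), ∀ x ∈ A.par ParOp.lub e,
      g .elem x ∈ B.par ParOp.lub fun n => g .ineq (e n)) :
    Model.Hom A B where
  map := g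
  map_tot := map_tot_of_basic g hs ht hv
  map_par o a x hx := by
    -- The operation is automatically defined on the images, and partial functions are
    -- single-valued, so it remains to compare two values. The laws in `A` and `B` describe both by
    -- the same data.
    have hd := Model.dom_of_map g (map_tot_of_basic g hs ht hv) o a hx.1
    obtain ⟨y, hy⟩ := Part.dom_iff_mem.1 hd
    suffices g _ x = y from this ▸ hy
    have hA := lawPar A o a
    have hB := lawPar B o fun i => g _ (a i)
    cases o with
    | irrelevance => exact (congrArg _ (hA x hx).1.symm).trans (hB y hy).1
    | antisym => exact ((congrArg _ (hA x hx).1.symm).trans (hs _)).trans (hB y hy).1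
    | trans =>
      exact ineq_ext
        ((hs _).symm.trans ((congrArg _ (hA x hx).1).trans ((hs _).trans (hB y hy).1.symm)))
        ((ht _).symm.trans ((congrArg _ (hA x hx).2).trans ((ht _).trans (hB y hy).2.symm)))
    | lub => exact Part.mem_unique (hl a x hx) hy
    | ub k =>
      -- The law for `ub` constrains the target only through a defined least upper bound; that one
      -- exists because `lub` has the same assumptions.
      obtain ⟨l, hl'⟩ := exists_mem_par (A := A) (o := .lub) (a := a)
        ((dom_iff_domCond A (.ub k) a).1 hx.1)
      exact ineq_ext
        ((hs _).symm.trans ((congrArg _ (hA x hx).1).trans ((hs _).trans (hB y hy).1.symm)))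
        ((ht _).symm.trans ((congrArg _ ((hA x hx).2 l hl')).trans
          ((hB y hy).2 _ (hl _ _ hl')).symm))
    | least =>
      obtain ⟨l, hl'⟩ := exists_mem_par (A := A) (o := .lub) (a := fun n => a (.inr (.inl n)))
        ((dom_iff_domCond A .least a).1 hx.1).1.1
      exact ineq_ext
        ((hs _).symm.trans ((congrArg _ ((hA x hx).1 l hl')).trans
          ((hB y hy).1 _ (hl _ _ hl')).symm))
        ((ht _).symm.trans ((congrArg _ (hA x hx).2).trans (hB y hy).2.symm))
    | extensionality => exact (congrArg _ (hA x hx).1.symm).trans (hB y hy).1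
    | rlub =>
      refine rand_ext fun r => ?_
      have hc := (dom_iff_domCond A .rlub a).1 hx.1
      obtain ⟨l, hl'⟩ := exists_mem_par (A := A) (o := .lub) (a := fun n => a (.inr (n, r)))
        fun n => (hc.2 (n, r)).trans (hc.1 (n + 1, r)).symm
      exact (hv r _).symm.trans ((congrArg _ (hA x hx r l hl')).trans
        (hB y hy r _ (hl _ _ hl')).symm)

end Pres

/-! ### The model of an ω-quasi-Borel space -/

namespace MeasPartition

variable (p : MeasPartition)

theorem exists_mem (r : ℝ) : ∃ i, r ∈ p.S i := Set.mem_iUnion.1 (p.cover ▸ Set.mem_univ r)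

/-- The index of the part that contains `r`. -/
noncomputable def index (r : ℝ) : p.I := (p.exists_mem r).choose

theorem mem_index (r : ℝ) : r ∈ p.S (p.index r) := (p.exists_mem r).choose_spec

theorem index_eq {r : ℝ} {i : p.I} (h : r ∈ p.S i) : p.index r = i := by
  by_contra hne
  exact Set.disjoint_left.1 (p.disj hne) (p.mem_index r) h

theorem glue_mem (X : QBS.{u}) (α : p.I → ℝ → X) (hα : ∀ i, α i ∈ X.rand) :
    (fun r => α (p.index r) r) ∈ X.rand := by
  classical
  -- Gluing wants a partition indexed by all natural numbers. Indices outside `p.I` get an empty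
  -- part, where the random element is irrelevant; `p.index 0` supplies one.
  refine X.glue_mem (fun n => {r | (p.index r).1 = n})
    (fun n => if h : n ∈ p.I then α ⟨n, h⟩ else α (p.index 0)) _
    (fun n => ?_) ?_ ?_ (fun n => ?_) ?_
  · by_cases h : n ∈ p.I
    · convert p.meas ⟨n, h⟩ using 1
      ext r
      constructor
      · intro hr
        have : p.index r = ⟨n, h⟩ := Subtype.ext hr
        exact this ▸ p.mem_index r
      · intro hr
        exact congrArg Subtype.val (p.index_eq hr)
    · convert MeasurableSet.empty using 1
      ext r
      simp only [Set.mem_ofPred_eq, Set.mem_empty_iff_false, iff_false]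
      rintro rfl
      exact h (p.index r).2
  · intro m n hmn
    refine Set.disjoint_left.2 fun r hm hn => hmn ?_
    exact hm.symm.trans hn
  · ext r
    simp
  · split_ifs with h
    · exact hα _
    · exact hα _
  · rintro n r rfl
    simp

end MeasPartition

namespace WQbs

open Pres

variable (P : WQbs.{u})

/-- The carriers of the model of an ω-quasi-Borel space. -/
def modelCarrier : Srt → Type u
  | .elem => P.carrier
  | .ineq => {p : P.carrier × P.carrier // p.1 ≤ p.2}
  | .rand => P.rand

variable {P}

/-- The chain of the sources of a sequence of composable inequations. -/
def pathChain (e : ℕ → {p : P.carrier × P.carrier // p.1 ≤ p.2})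
    (h : ∀ n, (e n).1.2 = (e (n + 1)).1.1) : Chain P.carrier :=
  ⟨⟨fun n => (e n).1.1, monotone_nat_of_le_succ fun n => (e n).2.trans (h n).le⟩⟩

variable (P)

/-- The total operations of the model of an ω-quasi-Borel space. -/
noncomputable def modelTot : (o : TotOp) → (∀ i, P.modelCarrier (tot.arg o i)) →
    P.modelCarrier (tot.res o)
  | .source, a => (a ()).1.1
  | .target, a => (a ()).1.2
  | .refl, a => ⟨(a (), a ()), le_rfl⟩
  | .ev r, a => (a ()).1 r
  | .const, a => ⟨fun _ => a (), P.const_mem _⟩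
  | .rearrange φ, a => ⟨(a ()).1 ∘ φ.1, P.comp_mem _ (a ()).2 φ.1 φ.2⟩
  | .cases p, a => ⟨fun r => (a (p.index r)).1 r,
      p.glue_mem P.toQBS (fun i => (a i).1) fun i => (a i).2⟩

/-- The partial operations of the model of an ω-quasi-Borel space. -/
def modelPar : (o : ParOp) → (∀ i, P.modelCarrier (par.arg o i)) →
    Part (P.modelCarrier (par.res o))
  | .irrelevance, (a : Fin 2 → P.modelCarrier .ineq) =>
      ⟨(a 0).1.1 = (a 1).1.1 ∧ (a 0).1.2 = (a 1).1.2, fun _ => a 0⟩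
  | .antisym, (a : Fin 2 → P.modelCarrier .ineq) =>
      ⟨(a 0).1.1 = (a 1).1.2 ∧ (a 0).1.2 = (a 1).1.1, fun _ => (a 0).1.1⟩
  | .trans, (a : Fin 2 → P.modelCarrier .ineq) =>
      ⟨(a 0).1.2 = (a 1).1.1,
        fun h => ⟨((a 0).1.1, (a 1).1.2), (a 0).2.trans (h.le.trans (a 1).2)⟩⟩
  | .lub, (a : ℕ → P.modelCarrier .ineq) =>
      ⟨∀ n, (a n).1.2 = (a (n + 1)).1.1, fun h => ωSup (α := P.carrier) (pathChain a h)⟩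
  | .ub k, (a : ℕ → P.modelCarrier .ineq) =>
      ⟨∀ n, (a n).1.2 = (a (n + 1)).1.1,
        fun h => ⟨((a k).1.1, ωSup (pathChain a h)), le_ωSup (pathChain a h) k⟩⟩
  | .least, a =>
      let x : P.carrier := a (.inl ())
      let e : ℕ → P.modelCarrier .ineq := fun n => a (.inr (.inl n))
      let b : ℕ → P.modelCarrier .ineq := fun n => a (.inr (.inr n))
      ⟨((∀ n, (e n).1.2 = (e (n + 1)).1.1) ∧ ∀ n, (b n).1.2 = x) ∧ ∀ n, (e n).1.1 = (b n).1.1,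
        fun h => ⟨(ωSup (pathChain e h.1.1), x), ωSup_le _ _ fun n =>
          (h.2 n).le.trans ((b n).2.trans (h.1.2 n).le)⟩⟩
  | .extensionality, (a : Fin 2 → P.modelCarrier .rand) =>
      ⟨∀ r, (a 0).1 r = (a 1).1 r, fun _ => a 0⟩
  | .rlub, a =>
      let α : ℕ → P.modelCarrier .rand := fun n => a (.inl n)
      let e : ℕ → ℝ → P.modelCarrier .ineq := fun n r => a (.inr (n, r))
      ⟨(∀ p : ℕ × ℝ, (e p.1 p.2).1.1 = (α p.1).1 p.2) ∧
        ∀ p : ℕ × ℝ, (e p.1 p.2).1.2 = (α (p.1 + 1)).1 p.2,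
        fun h => ⟨fun r => ωSup (pathChain (fun n => e n r)
            fun n => (h.2 (n, r)).trans (h.1 (n + 1, r)).symm),
          P.sup_mem ⟨⟨fun n r => (e n r).1.1, monotone_nat_of_le_succ fun n r =>
              (e n r).2.trans ((h.2 (n, r)).trans (h.1 (n + 1, r)).symm).le⟩⟩ fun n => by
            have : (fun r => (e n r).1.1) = (α n).1 := funext fun r => h.1 (n, r)
            exact (congrArg (· ∈ P.rand) this).mpr (α n).2⟩⟩

/-- The partial algebra of an ω-quasi-Borel space. -/
noncomputable def toAlgebra : PartialAlgebra.{u} wqbsPres where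
  carrier := P.modelCarrier
  tot := P.modelTot
  par := P.modelPar

theorem modelPar_dom (o : ParOp) (a : ∀ i, P.modelCarrier (par.arg o i)) :
    (P.modelPar o a).Dom ↔ DomCond (A := P.toAlgebra) o a := by
  cases o <;> exact Iff.rfl

theorem lawTot_toAlgebra (o : TotOp) (a : ∀ i, P.modelCarrier (tot.arg o i)) :
    LawTot (A := P.toAlgebra) o a := by
  cases o with
  | source | target | ev => trivial
  | refl => exact ⟨rfl, rfl⟩
  | const => exact fun _ => rfl
  | rearrange φ => exact fun _ => rfl
  | cases p =>
    rintro ⟨i, r, hr⟩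
    exact congrArg (fun j => (a j).1 r) (p.index_eq hr)

theorem lawPar_toAlgebra (o : ParOp) (a : ∀ i, P.modelCarrier (par.arg o i)) :
    LawPar (A := P.toAlgebra) o a := by
  cases o with
  | irrelevance =>
    rintro _ ⟨h, rfl⟩
    exact ⟨rfl, Subtype.ext (Prod.ext h.1 h.2)⟩
  | antisym =>
    rintro _ ⟨h, rfl⟩
    -- The two inequations run in opposite directions between the same elements, so antisymmetry
    -- identifies their sources.
    exact ⟨rfl, le_antisymm (α := P.carrier) ((a (0 : Fin 2)).2.trans h.2.le)
      ((a (1 : Fin 2)).2.trans h.1.symm.le)⟩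
  | trans =>
    rintro _ ⟨h, rfl⟩
    exact ⟨rfl, rfl⟩
  | lub => trivial
  | ub k =>
    rintro _ ⟨h, rfl⟩
    refine ⟨rfl, ?_⟩
    rintro _ ⟨h', rfl⟩
    rfl
  | least =>
    rintro _ ⟨h, rfl⟩
    refine ⟨?_, rfl⟩
    rintro _ ⟨h', rfl⟩
    rfl
  | extensionality =>
    rintro _ ⟨h, rfl⟩
    exact ⟨rfl, Subtype.ext (funext h)⟩
  | rlub =>
    rintro _ ⟨h, rfl⟩ r _ ⟨h', rfl⟩
    rfl

/-- The model of an ω-quasi-Borel space. -/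
noncomputable def toModelObj : Model.{u} wqbsPres where
  toPartialAlgebra := P.toAlgebra
  dom_iff o a := (P.modelPar_dom o a).trans (assum_iff o a).symm
  sat := sat_iff.2 ⟨P.lawTot_toAlgebra, P.lawPar_toAlgebra⟩

end WQbs
-- The fully faithful functor to models
namespace WQbs

open Pres

variable {P Q : WQbs.{u}}

/-- The family of maps between the carriers of the models. -/
def modelMap (f : WQbs.Hom P Q) : ∀ s, P.modelCarrier s → Q.modelCarrier s
  | .elem => f.toFun
  | .ineq => fun e => ⟨(f.toFun e.1.1, f.toFun e.1.2), f.monotone' e.2⟩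
  | .rand => fun α => ⟨f.toFun ∘ α.1, f.map_rand α.1 α.2⟩

/-- The homomorphism of models of a morphism of ω-quasi-Borel spaces. -/
noncomputable def toModelMap (f : WQbs.Hom P Q) : Model.Hom P.toModelObj Q.toModelObj :=
  homOfBasic (A := P.toModelObj) (B := Q.toModelObj) (modelMap f) (fun _ => rfl) (fun _ => rfl)
    (fun _ _ => rfl) (by
      rintro e _ ⟨h, rfl⟩
      refine ⟨fun n => congrArg f.toFun (h n), ?_⟩
      exact (f.map_ωSup' (pathChain e h)).symm)

/-- The functor from ω-quasi-Borel spaces to models. -/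
noncomputable def toModel : WQbs.{u} ⥤ Model.{u} wqbsPres where
  obj := toModelObj
  map f := toModelMap f
  map_id _ := Model.Hom.ext (funext fun s => by cases s <;> rfl)
  map_comp _ _ := Model.Hom.ext (funext fun s => by cases s <;> rfl)

instance : toModel.{u}.Faithful where
  map_injective {_ _} f g h :=
    WQbs.Hom.ext (congrArg (fun k => Model.Hom.map k Srt.elem) h : f.toFun = g.toFun)

instance : toModel.{u}.Full where
  map_surjective {P Q} (h : Model.Hom P.toModelObj Q.toModelObj) := by
    let f : P.carrier → Q.carrier := h.map Srt.elem
    have hs : ∀ e : P.modelCarrier .ineq, f e.1.1 = (h.map Srt.ineq e).1.1 :=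
      fun e => h.map_tot TotOp.source fun _ => e
    have ht : ∀ e : P.modelCarrier .ineq, f e.1.2 = (h.map Srt.ineq e).1.2 :=
      fun e => h.map_tot TotOp.target fun _ => e
    have hv : ∀ (α : P.modelCarrier .rand) r, f (α.1 r) = (h.map Srt.rand α).1 r :=
      fun α r => h.map_tot (TotOp.ev r) fun _ => α
    have hm : Monotone f := fun x y hxy =>
      (hs ⟨(x, y), hxy⟩).le.trans ((h.map Srt.ineq ⟨(x, y), hxy⟩).2.trans (ht ⟨(x, y), hxy⟩).ge)
    have hc : ∀ c : Chain P.carrier, f (ωSup c) = ωSup (c.map ⟨f, hm⟩) := by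
      intro c
      -- Consecutive terms of `c` form a composable path whose chain of sources is `c` itself, so
      -- preservation of `lub` yields preservation of the supremum.
      let e : ℕ → P.modelCarrier .ineq := fun n => ⟨(c n, c (n + 1)), c.monotone n.le_succ⟩
      obtain ⟨h₁, h₂⟩ := h.map_par ParOp.lub e (ωSup (α := P.carrier) c) ⟨fun _ => rfl, rfl⟩
      refine h₂.symm.trans (congrArg (ωSup (α := Q.carrier)) (Chain.ext (funext fun n => ?_)))
      exact (hs (e n)).symm
    refine ⟨⟨⟨⟨f, hm⟩, hc⟩, fun α hα => ?_⟩, ?_⟩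
    · have : f ∘ α = (h.map Srt.rand ⟨α, hα⟩).1 := funext (hv ⟨α, hα⟩)
      exact this ▸ (h.map Srt.rand ⟨α, hα⟩).2
    · refine Model.Hom.ext (funext fun s => funext fun x => ?_)
      cases s with
      | elem => rfl
      | ineq => exact Subtype.ext (Prod.ext (hs x) (ht x))
      | rand => exact Subtype.ext (funext (hv x))

end WQbs

/-! ### The ω-quasi-Borel space of a model -/

namespace Pres

variable (M : Model.{u} wqbsPres)

/-- The order on the elements of a model. -/
def elemLe (x y : Elem M.toPartialAlgebra) : Prop :=
  ∃ e : Ineq M.toPartialAlgebra, src e = x ∧ tgt e = y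

variable {M}

theorem exists_lub (e : ℕ → Ineq M.toPartialAlgebra) (h : ∀ n, tgt (e n) = src (e (n + 1))) :
    ∃ x : Elem M.toPartialAlgebra, x ∈ M.par ParOp.lub e :=
  exists_mem_par (o := .lub) (a := e) h

/-- The operation `ub k` is defined whenever `lub` is, and its value witnesses the inequality. -/
theorem le_of_mem_lub {e : ℕ → Ineq M.toPartialAlgebra} {x : Elem M.toPartialAlgebra}
    (hx : x ∈ M.par ParOp.lub e) (k : ℕ) : elemLe M (src (e k)) x := by
  obtain ⟨y, hy⟩ := exists_mem_par (A := M) (o := .ub k) (a := e)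
    ((dom_iff_domCond M .lub e).1 hx.1)
  have h := lawPar M (.ub k) e y hy
  exact ⟨y, h.1, h.2 x hx⟩

/-- Chosen witnesses of the bounds are the arguments `b` of `least`, whose value witnesses the
inequality. -/
theorem le_of_forall_le {e : ℕ → Ineq M.toPartialAlgebra} {x y : Elem M.toPartialAlgebra}
    (hx : x ∈ M.par ParOp.lub e) (h : ∀ k, elemLe M (src (e k)) y) : elemLe M x y := by
  choose b hb using h
  let a : ∀ i, M.carrier (par.arg ParOp.least i) := fun i => match i with
    | .inl () => y
    | .inr (.inl n) => e n
    | .inr (.inr n) => b n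
  obtain ⟨z, hz⟩ := exists_mem_par (A := M) (o := .least) (a := a)
    ⟨⟨(dom_iff_domCond M .lub e).1 hx.1, fun n => (hb n).2⟩, fun n => (hb n).1.symm⟩
  have h := lawPar M .least a z hz
  exact ⟨z, h.1 x hx, h.2⟩

variable (M)

/-- The elements of a model form a partial order. -/
abbrev elemPartialOrder : PartialOrder (Elem M.toPartialAlgebra) where
  le := elemLe M
  le_refl x := ⟨_, (lawTot M .refl fun _ => x).1, (lawTot M .refl fun _ => x).2.symm⟩
  le_trans x y z := by
    rintro ⟨e, rfl, rfl⟩ ⟨e', h, rfl⟩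
    obtain ⟨t, ht⟩ := exists_mem_par (A := M) (o := .trans)
      (a := fun i : Fin 2 => if i = 0 then e else e') h.symm
    exact ⟨t, lawPar M .trans _ t ht⟩
  le_antisymm x y := by
    rintro ⟨e, rfl, rfl⟩ ⟨e', h, h'⟩
    obtain ⟨t, ht⟩ := exists_mem_par (A := M) (o := .antisym)
      (a := fun i : Fin 2 => if i = 0 then e else e') ⟨h'.symm, h.symm⟩
    have h₁ := lawPar M .antisym _ t ht
    exact h₁.1.trans (h₁.2.trans h)

/-- The steps of a chain are witnessed by inequations. -/
theorem exists_path (c : letI := elemPartialOrder M; Chain (Elem M.toPartialAlgebra)) :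
    letI := elemPartialOrder M
    ∃ e : ℕ → Ineq M.toPartialAlgebra, (∀ n, src (e n) = c n) ∧
      (∀ n, tgt (e n) = src (e (n + 1))) ∧ ∃ x, x ∈ M.par ParOp.lub e := by
  let := elemPartialOrder M
  have h : ∀ n, elemLe M (c n) (c (n + 1)) := fun n => c.monotone' n.le_succ
  choose e he he' using h
  have h : ∀ n, tgt (e n) = src (e (n + 1)) := fun n => (he' n).trans (he (n + 1)).symm
  exact ⟨e, he, h, exists_lub e h⟩

/-- The elements of a model form an ωcpo. -/
noncomputable abbrev elemOmegaCompletePartialOrder :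
    OmegaCompletePartialOrder (Elem M.toPartialAlgebra) where
  toPartialOrder := elemPartialOrder M
  ωSup c := (exists_path M c).choose_spec.2.2.choose
  le_ωSup c n := by
    have h := (exists_path M c).choose_spec
    exact h.1 n ▸ le_of_mem_lub h.2.2.choose_spec n
  ωSup_le c x hx := by
    have h := (exists_path M c).choose_spec
    exact le_of_forall_le h.2.2.choose_spec fun k => (h.1 k).symm ▸ hx k

/-- Both sides are least upper bounds of the same chain, so the path chosen in the definition of
`ωSup` does not matter. -/
theorem eq_ωSup {e : ℕ → Ineq M.toPartialAlgebra} {x : Elem M.toPartialAlgebra}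
    (hx : x ∈ M.par ParOp.lub e)
    (c : letI := elemPartialOrder M; Chain (Elem M.toPartialAlgebra))
    (hc : letI := elemPartialOrder M; ∀ n, src (e n) = c n) :
    x = (elemOmegaCompletePartialOrder M).ωSup c := by
  let := elemOmegaCompletePartialOrder M
  refine le_antisymm ?_ ?_
  · exact le_of_forall_le hx fun k => (hc k).symm ▸ le_ωSup c k
  · exact ωSup_le c x fun k => hc k ▸ le_of_mem_lub hx k

/-- The ω-quasi-Borel space of a model. -/
noncomputable def toWQbs : WQbs.{u} where
  carrier := Elem M.toPartialAlgebra
  rand := Set.range fun (α : Rand M.toPartialAlgebra) r => val r α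
  const_mem x := ⟨M.tot TotOp.const fun _ => x, funext fun r => lawTot M .const (fun _ => x) r⟩
  comp_mem := by
    rintro _ ⟨α, rfl⟩ φ hφ
    exact ⟨M.tot (TotOp.rearrange ⟨φ, hφ⟩) fun _ => α,
      funext fun r => lawTot M (.rearrange ⟨φ, hφ⟩) (fun _ => α) r⟩
  glue_mem S α β hS hd hu hα hβ := by
    choose a ha using hα
    let p : MeasPartition :=
      { I := Set.univ
        S := fun i => S i
        meas := fun i => hS i
        disj := fun i j hij => hd fun h => hij (Subtype.ext h)
        cover := by
          rw [← hu]
          exact (Equiv.Set.univ ℕ).surjective.iUnion_comp S }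
    refine ⟨M.tot (TotOp.cases p) fun i => a i.1, funext fun r => ?_⟩
    have hr := p.mem_index r
    exact (lawTot M (.cases p) (fun i : p.I => a i.1) ⟨p.index r, r, hr⟩).trans
      ((congrFun (ha _) r).trans (hβ _ r hr).symm)
  str := elemOmegaCompletePartialOrder M
  sup_mem c hc := by
    let := elemOmegaCompletePartialOrder M
    choose α hα using hc
    have h : ∀ n r, elemLe M (val r (α n)) (val r (α (n + 1))) := by
      intro n r
      obtain ⟨e, he, he'⟩ := c.monotone' n.le_succ r
      exact ⟨e, he.trans (congrFun (hα n) r).symm, he'.trans (congrFun (hα (n + 1)) r).symm⟩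
    choose e he he' using h
    -- The arguments of `rlub` are the chosen representatives of the random elements and a witness
    -- for each step at each real.
    let a : ∀ i, M.carrier (par.arg ParOp.rlub i) := fun i => match i with
      | .inl n => α n
      | .inr (n, r) => e n r
    obtain ⟨β, hβ⟩ := exists_mem_par (A := M) (o := .rlub) (a := a)
      ⟨fun p => he p.1 p.2, fun p => he' p.1 p.2⟩
    refine ⟨β, funext fun r => ?_⟩
    obtain ⟨x, hx⟩ := exists_lub (fun n => e n r) fun n => (he' n r).trans (he (n + 1) r).symm
    refine (lawPar M .rlub a β hβ r x hx).trans (eq_ωSup M hx _ fun n => ?_)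
    exact (he n r).trans (congrFun (hα n) r)

/-- The comparison map from a model to the model of its ω-quasi-Borel space. -/
noncomputable def unitMap : ∀ s : Srt, M.carrier s → (toWQbs M).modelCarrier s
  | .elem => fun x => x
  | .ineq => fun e => ⟨(src e, tgt e), e, rfl, rfl⟩
  | .rand => fun α => ⟨fun r => val r α, α, rfl⟩

/-- The comparison homomorphism from a model to the model of its ω-quasi-Borel space. -/
noncomputable def unitHom : Model.Hom M (toWQbs M).toModelObj :=
  homOfBasic (B := (toWQbs M).toModelObj) (unitMap M) (fun _ => rfl) (fun _ => rfl)
    (fun _ _ => rfl) (by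
      intro e x hx
      refine ⟨(dom_iff_domCond M .lub e).1 hx.1, ?_⟩
      exact (eq_ωSup M hx _ fun n => rfl).symm)

/-- Injectivity is `irr` and `ext`; surjectivity holds because the order and the random elements of
the space are defined as images of the two sorts. -/
theorem unitHom_bijective (s : Srt) : Function.Bijective ((unitHom M).map s) := by
  cases s with
  | elem => exact Function.bijective_id
  | ineq =>
    refine ⟨fun e e' h => ?_, fun ⟨p, e, h₁, h₂⟩ => ⟨e, Subtype.ext (Prod.ext h₁ h₂)⟩⟩
    have h := congrArg Subtype.val h
    exact ineq_ext (congrArg Prod.fst h) (congrArg Prod.snd h)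
  | rand =>
    refine ⟨fun α β h => rand_ext fun r => ?_, fun ⟨f, α, h⟩ => ⟨α, Subtype.ext h⟩⟩
    exact congrFun (congrArg Subtype.val h) r

end Pres

namespace WQbs

instance : toModel.{u}.EssSurj where
  mem_essImage M :=
    ⟨Pres.toWQbs M, ⟨(Model.isoOfBijective (Pres.unitHom M) (Pres.unitHom_bijective M)).symm⟩⟩

/-- ω-quasi-Borel spaces are the same as models of their presentation. -/
noncomputable def equivModel : WQbs.{u} ≌ Model.{u} wqbsPres :=
  haveI : toModel.{u}.IsEquivalence := {}
  toModel.asEquivalence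

end WQbs
-- Countable coproducts of standard Borel spaces
section Sigma

theorem measurableSet_sigma {J : Type v} {X : J → Type w} [∀ j, MeasurableSpace (X j)]
    {s : Set (Σ j, X j)} : MeasurableSet s ↔ ∀ j, MeasurableSet (Sigma.mk j ⁻¹' s) :=
  MeasurableSpace.measurableSet_iInf

theorem measurable_of_sigma {J : Type v} {X : J → Type w} [∀ j, MeasurableSpace (X j)]
    {Y : Type u} [MeasurableSpace Y] (g : (Σ j, X j) → Y)
    (hg : ∀ j, Measurable fun x => g ⟨j, x⟩) : Measurable g :=
  fun _ hs => measurableSet_sigma.2 fun j => hg j hs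

theorem measurableEmbedding_sigmaMk {J : Type v} {X : J → Type w} [∀ j, MeasurableSpace (X j)]
    (j : J) : MeasurableEmbedding (Sigma.mk j : X j → Σ j, X j) where
  injective := sigma_mk_injective
  measurable := fun _ hs => measurableSet_sigma.1 hs j
  measurableSet_image' := fun s hs => measurableSet_sigma.2 fun i => by
    by_cases h : i = j
    · subst h
      rwa [Set.preimage_image_eq _ sigma_mk_injective]
    · convert MeasurableSet.empty using 1
      ext x
      simp [Ne.symm h]

theorem iUnion_sigmaMk_image {J : Type v} {X : J → Type w} (s : Set (Σ j, X j)) :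
    ⋃ j, Sigma.mk j '' (Sigma.mk j ⁻¹' s) = s := by
  ext ⟨j, x⟩
  simp only [Set.mem_iUnion, Set.mem_image, Set.mem_preimage]
  exact ⟨fun ⟨_, _, h, e⟩ => e ▸ h, fun h => ⟨j, x, h, rfl⟩⟩

/-- A set is the union of its traces on the summands. Each trace is Borel since the inclusions are
open embeddings, and countability of the index makes the union Borel. -/
theorem borel_sigma {J : Type v} [Countable J] {X : J → Type w} [∀ j, TopologicalSpace (X j)]
    [∀ j, MeasurableSpace (X j)] [∀ j, BorelSpace (X j)] {s : Set (Σ j, X j)} :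
    @MeasurableSet _ (borel (Σ j, X j)) s ↔ ∀ j, MeasurableSet (Sigma.mk j ⁻¹' s) := by
  let : MeasurableSpace (Σ j, X j) := borel _
  have : BorelSpace (Σ j, X j) := ⟨rfl⟩
  refine ⟨fun hs j => (Continuous.measurable continuous_sigmaMk) hs, fun hs => ?_⟩
  rw [← iUnion_sigmaMk_image s]
  exact MeasurableSet.iUnion fun j =>
    (Topology.IsOpenEmbedding.sigmaMk (i := j)).measurableEmbedding.measurableSet_image.2 (hs j)

/-- With Polish topologies chosen on the summands, the countable topological sum is Polish, and its
Borel sets are the measurable sets of the sum. -/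
theorem standardBorelSpace_sigma {J : Type v} [Countable J] (X : J → Type w)
    [∀ j, MeasurableSpace (X j)] [∀ j, StandardBorelSpace (X j)] :
    StandardBorelSpace (Σ j, X j) := by
  let := fun j => upgradeStandardBorel (X j)
  have : BorelSpace (Σ j, X j) :=
    ⟨MeasurableSpace.ext fun s => measurableSet_sigma.trans borel_sigma.symm⟩
  infer_instance

end Sigma

namespace Sbs

/-- The underlying function of a map of standard Borel spaces. -/
def fn {X Y : Sbs} (f : X ⟶ Y) : X.obj → Y.obj :=
  (show {f : X.obj → Y.obj // Measurable f} from f.hom).1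

theorem measurable_fn {X Y : Sbs} (f : X ⟶ Y) : Measurable (fn f) :=
  (show {f : X.obj → Y.obj // Measurable f} from f.hom).2

/-- A measurable function as a map of standard Borel spaces. -/
def ofFn {X Y : Sbs} (f : X.obj → Y.obj) (hf : Measurable f) : X ⟶ Y :=
  ObjectProperty.homMk (⟨f, hf⟩ : X.obj ⟶ Y.obj)

theorem hom_ext {X Y : Sbs} {f g : X ⟶ Y} (h : ∀ x, fn f x = fn g x) : f = g :=
  ObjectProperty.hom_ext _ (Subtype.ext (funext h))

/-- A point of a standard Borel space, as a map from the one-point space. -/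
def pt {X : Sbs} (x : X.obj) : one ⟶ X := ofFn (fun _ => x) measurable_const

/-- A measurable subset of a standard Borel space. -/
def sub {X : Sbs} (S : Set X.obj) (hS : MeasurableSet S) : Sbs :=
  ⟨MeasCat.of S, have := X.property; hS.standardBorel⟩

/-- A leg of a cone in the opposite category of standard Borel spaces. -/
def leg {J : Type} {K : Discrete J ⥤ Sbsᵒᵖ} (c : Limits.Cone K) (j : J) :
    (K.obj ⟨j⟩).unop ⟶ c.pt.unop :=
  (c.π.app ⟨j⟩).unop

/-- A cone in the opposite category of standard Borel spaces is a limit cone when its legs are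
measurable embeddings that jointly partition the apex. -/
noncomputable def isLimitOfPartition {J : Type} [Countable J] {K : Discrete J ⥤ Sbsᵒᵖ}
    (c : Limits.Cone K) (hc : ∀ j, MeasurableEmbedding (fn (leg c j)))
    (hb : Function.Bijective fun p : Σ j : J, (K.obj ⟨j⟩).unop.obj =>
      fn (leg c p.1) p.2) : Limits.IsLimit c :=
  let e := Equiv.ofBijective _ hb
  let d (s : Limits.Cone K) (p : Σ j : J, (K.obj ⟨j⟩).unop.obj) : s.pt.unop.obj :=
    fn (leg s p.1) p.2
  have hd (s : Limits.Cone K) : Measurable (d s ∘ e.symm) := by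
    intro U hU
    -- The legs carry measurable sets to measurable sets, so this countable union of images is
    -- measurable.
    have : (d s ∘ e.symm) ⁻¹' U =
        ⋃ j, fn (leg c j) '' (fn (leg s j) ⁻¹' U) := by
      ext x
      obtain ⟨p, rfl⟩ := e.surjective x
      simp only [Set.mem_preimage, Function.comp_apply, Equiv.symm_apply_apply, Set.mem_iUnion,
        Set.mem_image]
      constructor
      · intro h
        exact ⟨p.1, p.2, h, rfl⟩
      · rintro ⟨j, y, hy, h⟩
        have : (⟨j, y⟩ : Σ j : J, (K.obj ⟨j⟩).unop.obj) = p := e.injective h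
        exact this ▸ hy
    rw [this]
    exact MeasurableSet.iUnion fun j =>
      (hc j).measurableSet_image.2 (measurable_fn _ hU)
  { lift := fun s => (ofFn (d s ∘ e.symm) (hd s)).op
    fac := fun s ⟨j⟩ => Quiver.Hom.unop_inj (hom_ext fun y =>
      congrArg (d s) (e.symm_apply_apply ⟨j, y⟩))
    uniq := fun s m hm => Quiver.Hom.unop_inj (hom_ext fun x => by
      obtain ⟨p, rfl⟩ := e.surjective x
      refine Eq.trans ?_ (congrArg (d s) (e.symm_apply_apply p)).symm
      exact congrArg (fun k => fn (Quiver.Hom.unop k) p.2) (hm ⟨p.1⟩)) }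

end Sbs

/-- An element of a limit of a discrete diagram of ωcpos is given by its components. -/
theorem exists_unique_of_isLimit {J : Type} {K : Discrete J ⥤ ωCPO.{u}} {c : Limits.Cone K}
    (hc : Limits.IsLimit c) (x : ∀ j : J, (K.obj ⟨j⟩).carrier) :
    ∃! y : c.pt.carrier, ∀ j,
      (show c.pt.carrier →𝒄 (K.obj ⟨j⟩).carrier from c.π.app ⟨j⟩) y = x j := by
  -- Elements of an ωcpo are the continuous maps from the one-point ωcpo, so a family of components
  -- is a cone with that apex.
  let s : Limits.Cone K :=
    { pt := ωCPO.of PUnit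
      π := Discrete.natTrans fun ⟨j⟩ => ContinuousHom.const (x j) }
  have h (y : c.pt.carrier) (hy : ∀ j,
      (show c.pt.carrier →𝒄 (K.obj ⟨j⟩).carrier from c.π.app ⟨j⟩) y = x j) :
      (ContinuousHom.const y : PUnit →𝒄 c.pt.carrier) = hc.lift s :=
    hc.uniq s (ContinuousHom.const y) fun ⟨j⟩ => ContinuousHom.ext _ _ fun _ => hy j
  refine ⟨(show PUnit →𝒄 c.pt.carrier from hc.lift s) PUnit.unit, fun j => ?_, fun y hy => ?_⟩
  · exact congrArg (fun k => DFunLike.coe (F := PUnit →𝒄 (K.obj ⟨j⟩).carrier) k PUnit.unit)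
      (hc.fac s ⟨j⟩)
  · exact congrArg (fun k => DFunLike.coe (F := PUnit →𝒄 c.pt.carrier) k PUnit.unit) (h y hy)

namespace QBS

/-- A function that locally agrees with random elements is a random element. -/
theorem mem_rand_of_locally (X : QBS.{u}) {d : ℝ → ℕ} (hd : Measurable d) (β : ℝ → X)
    (h : ∀ r₀, ∃ α ∈ X.rand, ∀ r, d r = d r₀ → β r = α r) : β ∈ X.rand := by
  have : ∀ n, ∃ α ∈ X.rand, ∀ r, d r = n → β r = α r := by
    intro n
    by_cases hn : ∃ r₀, d r₀ = n
    · obtain ⟨r₀, rfl⟩ := hn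
      exact h r₀
    -- An empty fibre imposes no condition, so any constant serves.
    · exact ⟨_, X.const_mem (β 0), fun r hr => (hn ⟨r, hr⟩).elim⟩
  choose α hα hβ using this
  exact X.glue_mem (fun n => d ⁻¹' {n}) α β (fun n => hd (measurableSet_singleton n))
    (fun _ _ hmn => (Set.disjoint_singleton.2 hmn).preimage d)
    (by rw [← Set.preimage_iUnion, Set.iUnion_of_singleton, Set.preimage_univ]) hα
    fun n r hr => hβ n r hr

end QBS

/-! ### The sheaf of random variables -/

namespace WQbs

/-- The random variables with values in an ω-quasi-Borel space. -/
def IsRandom (P : WQbs.{u}) (X : Sbs) (f : X.obj → P.carrier) : Prop :=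
  ∀ φ : ℝ → X.obj, Measurable φ → f ∘ φ ∈ P.rand

instance (P : WQbs.{u}) (X : Sbs) : OmegaCompletePartialOrder (Subtype (P.IsRandom X)) :=
  OmegaCompletePartialOrder.subtype _ fun c hc φ hφ =>
    P.sup_mem ⟨⟨fun n => c n ∘ φ, fun _ _ h r => c.toOrderHom.monotone h (φ r)⟩⟩
      fun n => hc _ ⟨n, rfl⟩ φ hφ

/-- Precomposition with a measurable function. -/
def precomp (P : WQbs.{u}) {X Y : Sbs} (g : X ⟶ Y) :
    Subtype (P.IsRandom Y) →𝒄 Subtype (P.IsRandom X) where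
  toFun f := ⟨f.1 ∘ Sbs.fn g, fun _ hφ => f.2 _ ((Sbs.measurable_fn g).comp hφ)⟩
  monotone' _ _ h x := h (Sbs.fn g x)
  map_ωSup' _ := rfl

/-- The presheaf of random variables. -/
def presheaf (P : WQbs.{u}) : Sbsᵒᵖ ⥤ ωCPO.{u} where
  obj X := ωCPO.of (Subtype (P.IsRandom X.unop))
  map g := P.precomp g.unop
  map_id _ := rfl
  map_comp _ _ := rfl

section Sigma

variable {J : Type} [Countable J] (K : Discrete J ⥤ Sbsᵒᵖ)

/-- The coproduct of standard Borel spaces. -/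
def sigmaObj : Sbs :=
  ⟨MeasCat.of (Σ j : J, (K.obj ⟨j⟩).unop.obj),
    have := fun j : J => (K.obj ⟨j⟩).unop.property
    standardBorelSpace_sigma _⟩

/-- The coprojections of the coproduct of standard Borel spaces. -/
def sigmaInj (j : J) : (K.obj ⟨j⟩).unop ⟶ sigmaObj K :=
  Sbs.ofFn (fun x => ⟨j, x⟩)
    (measurableEmbedding_sigmaMk (X := fun j : J => (K.obj ⟨j⟩).unop.obj) j).measurable

/-- The coproduct cocone of standard Borel spaces. -/
def sigmaCone : Limits.Cone K where
  pt := .op (sigmaObj K)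
  π := Discrete.natTrans fun ⟨j⟩ => (sigmaInj K j).op

/-- The coproduct cocone is a colimit. -/
noncomputable def isLimitSigmaCone : Limits.IsLimit (sigmaCone K) :=
  Sbs.isLimitOfPartition _
    (fun j => measurableEmbedding_sigmaMk (X := fun j : J => (K.obj ⟨j⟩).unop.obj) j)
    Function.bijective_id

/-- The index of the summand containing `φ r` is measurable in `r` and takes countably many values;
where it is constant, `φ` factors through one summand. -/
theorem isRandom_sigma (P : WQbs.{u}) (f : ∀ j : J, (K.obj ⟨j⟩).unop.obj → P.carrier)
    (hf : ∀ j, P.IsRandom (K.obj ⟨j⟩).unop (f j)) :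
    P.IsRandom (sigmaObj K) fun p => f p.1 p.2 := by
  classical
  intro φ hφ
  let _ := Encodable.ofCountable J
  let φ' : ℝ → Σ j : J, (K.obj ⟨j⟩).unop.obj := φ
  have hφ' : Measurable φ' := hφ
  refine P.mem_rand_of_locally (d := fun r => Encodable.encode (φ' r).1)
    ((measurable_of_sigma (fun p => Encodable.encode p.1) fun j =>
      measurable_const (a := Encodable.encode j)).comp hφ') _ fun r₀ => ?_
  -- A measurable retraction of the coproduct onto the summand of `φ' r₀`; all other summands go to
  -- the point `φ' r₀`, which also shows that the summand is nonempty.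
  let g : (Σ j : J, (K.obj ⟨j⟩).unop.obj) → (K.obj ⟨(φ' r₀).1⟩).unop.obj := fun p =>
    if h : p.1 = (φ' r₀).1 then h ▸ p.2 else (φ' r₀).2
  have hg : Measurable g := measurable_of_sigma g fun j => by
    by_cases h : j = (φ' r₀).1
    · subst h
      simp only [g, dite_true]
      exact measurable_id
    · simp [g, h]
  refine ⟨f _ ∘ (g ∘ φ'), hf _ _ (hg.comp hφ'), fun r hr => ?_⟩
  have hr : (φ' r).1 = (φ' r₀).1 := Encodable.encode_injective hr
  change f (φ' r).1 (φ' r).2 = f _ (g (φ' r))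
  generalize φ' r = p at hr
  obtain ⟨j, y⟩ := p
  obtain rfl : j = (φ' r₀).1 := hr
  simp [g]

end Sigma

end WQbs

namespace WQbs

/-- The presheaf of random variables sends countable coproducts to products. -/
noncomputable def isLimitPresheafSigmaCone (P : WQbs.{u}) {J : Type} [Countable J]
    (K : Discrete J ⥤ Sbsᵒᵖ) : Limits.IsLimit (P.presheaf.mapCone (sigmaCone K)) :=
  let l (s : Limits.Cone (K ⋙ P.presheaf)) (j : J) :
      s.pt.carrier →𝒄 Subtype (P.IsRandom (K.obj ⟨j⟩).unop) := s.π.app ⟨j⟩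
  { lift := fun s => show s.pt.carrier →𝒄 Subtype (P.IsRandom (sigmaObj K)) from
      { toFun := fun x => ⟨fun p => (l s p.1 x).1 p.2,
          isRandom_sigma K P (fun j => (l s j x).1) fun j => (l s j x).2⟩
        monotone' := fun _ _ h p => (l s p.1).monotone h p.2
        map_ωSup' := fun c => Subtype.ext (funext fun p =>
          congrFun (congrArg Subtype.val ((l s p.1).continuous c)) p.2) }
    fac := fun _ _ => rfl
    uniq := fun s m hm => ContinuousHom.ext _ _ fun x => Subtype.ext (funext fun p => by
      have h := congrArg (fun k : s.pt.carrier →𝒄 Subtype (P.IsRandom (K.obj ⟨p.1⟩).unop) =>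
        (k x).1 p.2) (hm ⟨p.1⟩)
      exact h) }

theorem isSeparatedSheaf_presheaf (P : WQbs.{u}) : IsSeparatedSheaf P.presheaf :=
  ⟨fun _ _ => ⟨fun {K} => Limits.preservesLimit_of_preserves_limit_cone (isLimitSigmaCone K)
    (P.isLimitPresheafSigmaCone K)⟩, fun _ _ h r => h r ()⟩

/-- Postcomposition of random variables with a morphism. -/
def postcomp {P Q : WQbs.{u}} (f : WQbs.Hom P Q) (X : Sbs) :
    Subtype (P.IsRandom X) →𝒄 Subtype (Q.IsRandom X) where
  toFun g := ⟨f.toFun ∘ g.1, fun φ hφ => f.map_rand _ (g.2 φ hφ)⟩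
  monotone' _ _ h x := f.monotone' (h x)
  map_ωSup' c := Subtype.ext (funext fun x =>
    f.map_ωSup' ((c.map (OrderHom.Subtype.val _)).map (Pi.evalOrderHom x)))

/-- The functor from ω-quasi-Borel spaces to separated sheaves. -/
def toWE : WQbs.{u} ⥤ WE.{u} where
  obj P := ⟨P.presheaf, P.isSeparatedSheaf_presheaf⟩
  map f := ObjectProperty.homMk
    { app := fun X => postcomp f X.unop, naturality := fun _ _ _ => rfl }
  map_id _ := rfl
  map_comp _ _ := rfl

/-- The constant random variable on the one-point space. -/
def constOne {P : WQbs.{u}} (x : P.carrier) : Subtype (P.IsRandom Sbs.one) :=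
  ⟨fun _ => x, fun _ _ => P.const_mem x⟩

/-- The component of a morphism of presheaves of random variables. -/
def component {P Q : WQbs.{u}} (η : P.presheaf ⟶ Q.presheaf) (X : Sbs) :
    Subtype (P.IsRandom X) →𝒄 Subtype (Q.IsRandom X) :=
  η.app (.op X)

/-- Naturality along the point `x` of `X`: a morphism of these presheaves is determined by its
component at the one-point space. -/
theorem component_apply {P Q : WQbs.{u}} (η : P.presheaf ⟶ Q.presheaf) (X : Sbs)
    (f : Subtype (P.IsRandom X)) (x : X.obj) :
    (component η X f).1 x = (component η Sbs.one (constOne (f.1 x))).1 () :=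
  congrArg (fun k : Subtype (P.IsRandom X) →𝒄 Subtype (Q.IsRandom Sbs.one) => (k f).1 ())
    (η.naturality (Sbs.pt x).op).symm

instance : toWE.{u}.Faithful where
  map_injective {P Q} f g h := by
    refine WQbs.Hom.ext (funext fun x => ?_ : f.toFun = g.toFun)
    exact congrArg (fun k : toWE.obj P ⟶ toWE.obj Q =>
      (component (P := P) (Q := Q) k.hom Sbs.one (constOne x)).1 ()) h

instance : toWE.{u}.Full where
  map_surjective {P Q} η := by
    let η' : P.presheaf ⟶ Q.presheaf := η.hom
    let f : P.carrier → Q.carrier := fun x => (component η' Sbs.one (constOne x)).1 ()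
    have hm : Monotone f := fun x y h =>
      (component η' Sbs.one).monotone (show constOne x ≤ constOne y from fun _ => h) ()
    have hc : ∀ c : Chain P.carrier, f (ωSup c) = ωSup (c.map ⟨f, hm⟩) := fun c =>
      congrArg (fun k : Subtype (Q.IsRandom Sbs.one) => k.1 ())
        ((component η' Sbs.one).continuous
          (c.map ⟨constOne, fun _ _ h _ => h⟩ : Chain (Subtype (P.IsRandom Sbs.one))))
    refine ⟨⟨⟨⟨f, hm⟩, hc⟩, fun α hα => ?_⟩, ?_⟩
    -- Random elements are the sections over the line, so the component at the line shows that `f ∘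
    -- α` is random.
    · let a : Subtype (P.IsRandom Sbs.real) := ⟨α, fun φ hφ => P.comp_mem α hα φ hφ⟩
      have : f ∘ α = (component η' Sbs.real a).1 ∘ fun r => r :=
        funext fun r => (component_apply η' Sbs.real a r).symm
      exact this ▸ (component η' Sbs.real a).2 _ measurable_id
    · refine ObjectProperty.hom_ext _ (NatTrans.ext (funext fun X => ?_))
      refine ContinuousHom.ext _ _ fun g => Subtype.ext (funext fun x => ?_)
      exact (component_apply η' X.unop g x).symm

end WQbs

/-! ### Separated sheaves are sheaves of random variables -/

namespace WE

variable (F : Sbsᵒᵖ ⥤ ωCPO.{u})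

/-- The restriction along a map of standard Borel spaces. -/
def res {X Y : Sbs} (f : X ⟶ Y) : (F.obj (.op Y)).carrier →𝒄 (F.obj (.op X)).carrier :=
  F.map f.op

theorem res_comp {X Y Z : Sbs} (f : X ⟶ Y) (g : Y ⟶ Z) (a : (F.obj (.op Z)).carrier) :
    res F (f ≫ g) a = res F f (res F g a) :=
  ContinuousHom.congr_fun (F.map_comp g.op f.op) a

theorem res_id {X : Sbs} (a : (F.obj (.op X)).carrier) : res F (𝟙 X) a = a :=
  ContinuousHom.congr_fun (F.map_id (.op X)) a

/-- The value of a section at a point. -/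
def value {X : Sbs} (x : X.obj) : (F.obj (.op X)).carrier →𝒄 (F.obj (.op Sbs.one)).carrier :=
  res F (Sbs.pt x)

theorem value_res {X Y : Sbs} (f : X ⟶ Y) (x : X.obj) (a : (F.obj (.op Y)).carrier) :
    value F x (res F f a) = value F (Sbs.fn f x) a :=
  (res_comp F (Sbs.pt x) f a).symm

/-- The inclusion of a measurable subset. -/
def subIncl {X : Sbs} (S : Set X.obj) (hS : MeasurableSet S) : Sbs.sub S hS ⟶ X :=
  Sbs.ofFn (X := Sbs.sub S hS) Subtype.val measurable_subtype_coe

variable {F}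

/-- A countable measurable partition exhibits the space as the coproduct of its parts, which the
sheaf sends to a product. -/
theorem exists_unique_glue (hF : IsSeparatedSheaf F) {X : Sbs} {J : Type} [Countable J]
    (S : J → Set X.obj)
    (hS : ∀ j, MeasurableSet (S j)) (hd : Pairwise fun i j => Disjoint (S i) (S j))
    (hu : (⋃ j, S j) = Set.univ) (a : ∀ j, (F.obj (.op (Sbs.sub (S j) (hS j)))).carrier) :
    ∃! b : (F.obj (.op X)).carrier, ∀ j, res F (subIncl (S j) (hS j)) b = a j := by
  let K : Discrete J ⥤ Sbsᵒᵖ := Discrete.functor fun j => .op (Sbs.sub (S j) (hS j))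
  let c : Limits.Cone K :=
    { pt := .op X
      π := Discrete.natTrans fun ⟨j⟩ => (subIncl (S j) (hS j)).op }
  have hc : Limits.IsLimit c := by
    refine Sbs.isLimitOfPartition c (fun j => MeasurableEmbedding.subtype_coe (hS j)) ⟨?_, ?_⟩
    · rintro ⟨i, x, hx⟩ ⟨j, y, hy⟩ h
      obtain rfl : x = y := h
      obtain rfl : i = j := by
        by_contra hij
        exact Set.disjoint_left.1 (hd hij) hx hy
      rfl
    · intro x
      obtain ⟨j, hj⟩ := Set.mem_iUnion.1 (hu ▸ Set.mem_univ x)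
      exact ⟨⟨j, x, hj⟩, rfl⟩
  have := hF.1 J
  exact exists_unique_of_isLimit (Limits.isLimitOfPreserves F hc) a

/-- Gluing along the partition with no parts. -/
theorem exists_unique_of_isEmpty (hF : IsSeparatedSheaf F) {X : Sbs} (hX : IsEmpty X.obj) :
    ∃! _ : (F.obj (.op X)).carrier, True := by
  obtain ⟨b, -, hb⟩ := exists_unique_glue hF (X := X) (J := PEmpty) (fun j => j.elim)
    (fun j => j.elim) (fun j => j.elim) (Set.eq_univ_of_forall fun x => hX.elim x) fun j => j.elim
  exact ⟨b, trivial, fun y _ => hb y fun j => j.elim⟩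

/-- A standard Borel space embeds measurably in the line, and nonemptiness provides a default value
for the measurable left inverse. -/
theorem exists_retraction {X : Sbs} (hX : Nonempty X.obj) :
    ∃ (s : X ⟶ Sbs.real) (t : Sbs.real ⟶ X), s ≫ t = 𝟙 X := by
  have := X.property
  have he := MeasureTheory.measurableEmbedding_embeddingReal X.obj
  refine ⟨Sbs.ofFn (Y := Sbs.real) _ he.measurable,
    Sbs.ofFn (X := Sbs.real) he.invFun he.measurable_invFun, Sbs.hom_ext fun x => ?_⟩
  exact he.leftInverse_invFun x

/-- Order reflection is assumed only over the line. A nonempty space is a retract of it: sections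
are compared there after restriction along `t`, then restricted back along `s`. -/
theorem le_of_value_le (hF : IsSeparatedSheaf F) {X : Sbs} {a b : (F.obj (.op X)).carrier}
    (h : ∀ x : X.obj, value F x a ≤ value F x b) : a ≤ b := by
  rcases isEmpty_or_nonempty X.obj with hX | hX
  · exact ((exists_unique_of_isEmpty hF hX).unique trivial trivial).le
  · obtain ⟨s, t, hst⟩ := exists_retraction hX
    have ht : res F t a ≤ res F t b := hF.2 _ _ fun r =>
      (value_res F t r a).le.trans ((h (Sbs.fn t r)).trans (value_res F t r b).ge)
    have := (res F s).monotone ht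
    rwa [← res_comp, ← res_comp, hst, res_id, res_id] at this

theorem ext_of_value_eq (hF : IsSeparatedSheaf F) {X : Sbs} {a b : (F.obj (.op X)).carrier}
    (h : ∀ x : X.obj, value F x a = value F x b) : a = b :=
  le_antisymm (le_of_value_le hF fun x => (h x).le) (le_of_value_le hF fun x => (h x).ge)

variable (hF : IsSeparatedSheaf F)

/-- The ω-quasi-Borel space of points of a separated sheaf. -/
def toWQbs : WQbs.{u} where
  carrier := (F.obj (.op Sbs.one)).carrier
  rand := Set.range fun (a : (F.obj (.op Sbs.real)).carrier) (r : ℝ) => value F (X := Sbs.real) r a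
  const_mem x := by
    let f : Sbs.real ⟶ Sbs.one := Sbs.ofFn (Y := Sbs.one) (fun _ => ()) measurable_const
    refine ⟨res F f x, funext fun r => (value_res F f r x).trans ?_⟩
    exact res_id F x
  comp_mem := by
    rintro _ ⟨a, rfl⟩ φ hφ
    let f : Sbs.real ⟶ Sbs.real := Sbs.ofFn (X := Sbs.real) (Y := Sbs.real) φ hφ
    exact ⟨res F f a, funext fun r => value_res F f r a⟩
  glue_mem S α β hS hd hu hα hβ := by
    choose a ha using hα
    obtain ⟨b, hb, -⟩ := exists_unique_glue hF (X := Sbs.real) S hS hd hu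
      fun n => res F (subIncl (X := Sbs.real) (S n) (hS n)) (a n)
    refine ⟨b, funext fun r => ?_⟩
    obtain ⟨n, hn⟩ := Set.mem_iUnion.1 (hu ▸ Set.mem_univ r)
    have h := congrArg (value F (X := Sbs.sub (X := Sbs.real) (S n) (hS n)) ⟨r, hn⟩) (hb n)
    exact (value_res F _ _ b).symm.trans (h.trans (value_res F _ _ (a n))) |>.trans
      ((congrFun (ha n) r).trans (hβ n r hn).symm)
  sup_mem c hc := by
    choose a ha using hc
    -- Separation turns the pointwise inequalities into inequalities of the chosen sections, whose
    -- supremum then represents the pointwise one.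
    have hm : Monotone a := fun m n hmn => le_of_value_le hF fun r =>
      (congrFun (ha m) r).le.trans ((c.monotone hmn r).trans (congrFun (ha n) r).ge)
    refine ⟨ωSup ⟨⟨a, hm⟩⟩, funext fun r => ?_⟩
    refine ((value F (X := Sbs.real) r).continuous _).trans (congrArg ωSup (Chain.ext ?_))
    exact funext fun n => congrFun (ha n) r

theorem isRandom_value {X : Sbs} (a : (F.obj (.op X)).carrier) :
    (toWQbs hF).IsRandom X fun x => value F x a := fun φ hφ =>
  ⟨res F (Sbs.ofFn (X := Sbs.real) φ hφ) a, funext fun r =>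
    value_res F (Sbs.ofFn (X := Sbs.real) φ hφ) r a⟩

/-- For a retraction `t` with section `s`, the function `f ∘ t` is a random element and hence comes
from a section over the line; restricting that along `s` gives back `f`. -/
theorem exists_value_eq {X : Sbs} (f : X.obj → (toWQbs hF).carrier)
    (hf : (toWQbs hF).IsRandom X f) :
    ∃ a : (F.obj (.op X)).carrier, (fun x => value F x a) = f := by
  rcases isEmpty_or_nonempty X.obj with hX | hX
  · obtain ⟨a, -⟩ := exists_unique_of_isEmpty hF hX
    exact ⟨a, funext fun x => hX.elim x⟩
  · obtain ⟨s, t, hst⟩ := exists_retraction hX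
    obtain ⟨b, hb⟩ := hf _ (Sbs.measurable_fn t)
    refine ⟨res F s b, funext fun x => (value_res F s x b).trans ?_⟩
    refine (congrFun hb (Sbs.fn s x)).trans (congrArg f ?_)
    exact congrArg (fun k => Sbs.fn k x) hst

/-- The sections of a separated sheaf, as random variables with values in its points. -/
def sectionMap (X : Sbs) :
    (F.obj (.op X)).carrier →𝒄 Subtype ((toWQbs hF).IsRandom X) where
  toFun a := ⟨fun x => value F x a, isRandom_value hF a⟩
  monotone' _ _ h x := (value F x).monotone h
  map_ωSup' c := Subtype.ext (funext fun x => (value F x).continuous c)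

theorem sectionMap_bijective (X : Sbs) : Function.Bijective (sectionMap hF X) :=
  ⟨fun _ _ h => ext_of_value_eq hF fun x => congrFun (congrArg Subtype.val h) x,
    fun f => (exists_value_eq hF f.1 f.2).imp fun _ h => Subtype.ext h⟩

/-- A bijective full mono of ωcpos is an isomorphism. -/
noncomputable def isoOfBijective {P Q : ωCPO.{u}} (f : P.carrier →𝒄 Q.carrier)
    (hf : Function.Bijective f) (hm : FullMono f) : P ≅ Q :=
  let g := Function.surjInv hf.2
  have hfg : ∀ y, f (g y) = y := Function.surjInv_eq hf.2
  -- A bijective continuous map need not have a monotone inverse; reflection of the order is used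
  -- here.
  have hg : Monotone g := fun x y h => hm _ _ (by rwa [hfg, hfg])
  { hom := f
    inv := (⟨⟨g, hg⟩, fun c => hf.1 ((hfg _).trans (by
      rw [f.continuous]
      exact congrArg ωSup (Chain.ext (funext fun n => (hfg (c n)).symm))))⟩ :
        Q.carrier →𝒄 P.carrier)
    hom_inv_id := ContinuousHom.ext _ _ (Function.leftInverse_surjInv hf)
    inv_hom_id := ContinuousHom.ext _ _ hfg }

/-- A separated sheaf is isomorphic to the sheaf of random variables with values in its points. -/
noncomputable def sectionIso : F ≅ (toWQbs hF).presheaf :=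
  NatIso.ofComponents
    (fun X => isoOfBijective (Q := (toWQbs hF).presheaf.obj X) (sectionMap hF X.unop)
      (sectionMap_bijective hF X.unop) fun _ _ h => le_of_value_le hF fun x => h x)
    fun g => ContinuousHom.ext _ _ fun a => Subtype.ext (funext fun x => value_res F g.unop x a)

end WE

namespace WQbs

instance : toWE.{u}.EssSurj where
  mem_essImage F := ⟨WE.toWQbs F.property,
    ⟨(ObjectProperty.isoMk _ (WE.sectionIso F.property).symm :
      toWE.obj (WE.toWQbs F.property) ≅ F)⟩⟩

/-- ω-quasi-Borel spaces are the same as separated sheaves of ωcpos. -/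
noncomputable def equivWE : WQbs.{u} ≌ WE.{u} :=
  haveI : toWE.{u}.IsEquivalence := {}
  toWE.asEquivalence

end WQbs

end QBorel

theorem mainTheorem6 :
    Nonempty (QBorel.WQbs.{u} ≌ QBorel.WE.{u}) ∧
    Nonempty (QBorel.WE.{u} ≌ QBorel.IntWCpo.{u}) ∧
    Nonempty (QBorel.IntWCpo.{u} ≌ QBorel.Model.{u} QBorel.wqbsPres) :=
  ⟨⟨QBorel.WQbs.equivWE⟩,
    ⟨QBorel.WQbs.equivWE.symm.trans QBorel.WQbs.equivInt⟩,
    ⟨QBorel.WQbs.equivInt.symm.trans QBorel.WQbs.equivModel⟩⟩
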